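/- Let $R$ be a commutative ring and $S$ a scheme. Group schemes are commutative. An $R$-module scheme over $S$ is a group scheme over $S$ with an action of $R$, i.e. a representable functor from $S$-schemes to $R$-modules. $\mathrm{Hom}^R$, $\mathrm{Mult}^R$ and $\mathrm{Alt}^R$ denote the $R$-modules of $R$-linear, $R$-multilinear and alternating $R$-multilinear morphisms; $\mathrm{Alt}^R(M^a\times P^b,N)$ is the module of $R$-multilinear morphisms that are alternating in $M^a$ and in $P^b$. We write $\underline{\mathrm{Hom}}^R$, $\underline{\mathrm{Mult}}^R$, $\underline{\mathrm{Alt}}^R$ for the corresponding inner functors $T\mapsto \mathrm{Hom}^R_T$, $\mathrm{Mult}^R_T$, $\mathrm{Alt}^R_T$ of base changes to $S$-schemes $T$; such a functor is said to exist if it is representable by an $R$-module scheme over $S$. A morphism to a group scheme is pseudo-$R$-multilinear if it is $\mathbb Z$-multilinear and scalars of $R$ can be moved from one argument to another. For $n\ge1$, $\bigwedge^n_R M$ is the target of the universal alternating pseudo-$R$-multilinear morphism $\lambda$ from $M^n$ to group schemes over $S$, and $\otimes_R$ is the target of the universal pseudo-$R$-bilinear morphism; both carry the $R$-module structure for which the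 universal morphism is $R$-multilinear. $\bigwedge_R^0M$ is the constant scheme $R$. ``$\bigwedge^n_RM=0$'' means that $\bigwedge^n_RM$ exists and is zero. Let $0\to M_1\xrightarrow{\iota} M_2\xrightarrow{\pi} M_3\to 0$ be a short exact sequence of $R$-module schemes over $S$ (exact as fppf sheaves), and let $n_2=n_1+n_3$ with integers $n_1,n_3\ge 0$. For an $R$-module scheme $N$ over $S$ let $$\rho:\mathrm{Alt}^R(M_2^{n_2},N)\to \mathrm{Alt}^R(M_1^{n_1}\times M_2^{n_3},N),\qquad \pi^*:\mathrm{Alt}^R(M_1^{n_1}\times M_3^{n_3},N)\to \mathrm{Alt}^R(M_1^{n_1}\times M_2^{n_3},N)$$ be restriction along $\iota^{n_1}\times\mathrm{Id}^{n_3}$ and composition with $\mathrm{Id}^{n_1}\times\pi^{n_3}$. The map $\pi^*$ is injective for every $N$. Call $N$ admissible if $\underline{\mathrm{Mult}}^R(P_1\times\dots\times P_r,N)$ exists for all $0\le r<n_2$ and all $P_i\in\{M_1,M_2,M_3\}$. (a) If $\bigwedge_R^{n_3+1}M_3=0$, then $\rho$ is injective for every admissible $N$. (b) If $\bigwedge_R^{n_1+1}M_1=0$,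 then for every admissible $N$ the map $\rho$ factors through $\pi^*$, i.e. $\rho=\pi^*\circ\mu$ for an $R$-linear map $\mu:\mathrm{Alt}^R(M_2^{n_2},N)\to\mathrm{Alt}^R(M_1^{n_1}\times M_3^{n_3},N)$. (c) Suppose both conditions hold, that the exterior powers $\bigwedge^{n_i}_RM_i$ ($i=1,2,3$), with universal morphisms $\lambda_i$, and the tensor product $T=\bigwedge^{n_1}_RM_1\otimes_R\bigwedge^{n_3}_RM_3$ exist, that $N=\bigwedge^{n_2}_RM_2$ is admissible, and that $\underline{\mathrm{Alt}}^R(M_3^{n_3},N)$ and $\underline{\mathrm{Hom}}^R(\bigwedge_R^{n_1}M_1,N)$ exist for this $N$. Then there is a unique $R$-linear homomorphism $$\zeta:\ \bigwedge\nolimits^{n_1}_RM_1\otimes_R\bigwedge\nolimits^{n_3}_RM_3\longrightarrow\bigwedge\nolimits^{n_2}_RM_2,\qquad \zeta\bigl(\lambda_1(x)\otimes\lambda_3(\pi y)\bigr)=\lambda_2(\iota x,y)\quad (x\in M_1^{n_1},\ y\in M_2^{n_3}),$$ and it is an epimorphism with respect to all admissible $N$: the map $\mathrm{Hom}^R(\bigwedge^{n_2}_RM_2,N)\to\mathrm{Hom}^R(T,N)$,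 $f\mapsto f\circ\zeta$, is injective. In particular, if all $R$-module schemes over $S$ are admissible, $\zeta$ is an epimorphism in the category of $R$-module schemes over $S$. (d) If, in (c), the sequence moreover splits, and $\underline{\mathrm{Alt}}^R(M_3^{n_3},T)$ and $\underline{\mathrm{Hom}}^R(\bigwedge_R^{n_1}M_1,T)$ exist, then $\zeta$ is an isomorphism. -/

import Mathlib

open CategoryTheory AlgebraicGeometry Opposite

universe u v w₁ w₂

namespace RModuleSchemes

/-! ### Multilinear and alternating morphisms of presheaves of `R`-modules -/

section Presheaves

variable {R : Type v} [CommRing R] {D : Type w₁} [Category.{w₂} D]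

/-- `Mult^R(F_1 × ⋯ × F_r, G)`: the `R`-module of `R`-multilinear morphisms of presheaves. -/
def Mult {r : ℕ} (F : Fin r → Dᵒᵖ ⥤ ModuleCat.{u} R) (G : Dᵒᵖ ⥤ ModuleCat.{u} R) :
    Submodule R (∀ X : Dᵒᵖ, MultilinearMap R (fun i => (F i).obj X) (G.obj X)) where
  carrier := {φ | ∀ (X Y : Dᵒᵖ) (f : X ⟶ Y) (x : ∀ i, (F i).obj X),
    (G.map f) (φ X x) = φ Y (fun i => ((F i).map f) (x i))}
  add_mem' := by
    intro a b ha hb X Y f x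
    simp [ha X Y f x, hb X Y f x]
  zero_mem' := by
    intro X Y f x
    simp
  smul_mem' := by
    intro c a ha X Y f x
    simp [ha X Y f x]

/-- `Alt^R(F^n, G)`: the `R`-module of alternating `R`-multilinear morphisms of presheaves. -/
def Alt (F G : Dᵒᵖ ⥤ ModuleCat.{u} R) (n : ℕ) :
    Submodule R (∀ X : Dᵒᵖ, (F.obj X) [⋀^Fin n]→ₗ[R] (G.obj X)) where
  carrier := {φ | ∀ (X Y : Dᵒᵖ) (f : X ⟶ Y) (x : Fin n → F.obj X),
    (G.map f) (φ X x) = φ Y (fun i => (F.map f) (x i))}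
  add_mem' := by
    intro a b ha hb X Y f x
    simp [ha X Y f x, hb X Y f x]
  zero_mem' := by
    intro X Y f x
    simp
  smul_mem' := by
    intro c a ha X Y f x
    simp [ha X Y f x]

/-- `Alt^R(F₁^n × F₂^m, G)`: the `R`-module of `R`-multilinear morphisms of presheaves
that are alternating in `F₁^n` and in `F₂^m`. -/
def BiAlt (F₁ F₂ G : Dᵒᵖ ⥤ ModuleCat.{u} R) (n m : ℕ) :
    Submodule R (∀ X : Dᵒᵖ,
      (F₁.obj X) [⋀^Fin n]→ₗ[R] ((F₂.obj X) [⋀^Fin m]→ₗ[R] (G.obj X))) where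
  carrier := {φ | ∀ (X Y : Dᵒᵖ) (f : X ⟶ Y) (x : Fin n → F₁.obj X) (y : Fin m → F₂.obj X),
    (G.map f) (φ X x y) = φ Y (fun i => (F₁.map f) (x i)) (fun j => (F₂.map f) (y j))}
  add_mem' := by
    intro a b ha hb X Y f x y
    simp [ha X Y f x y, hb X Y f x y]
  zero_mem' := by
    intro X Y f x y
    simp
  smul_mem' := by
    intro c a ha X Y f x y
    simp [ha X Y f x y]

/-- `Mult^R(F₁ × F₂, G)`: the `R`-module of `R`-bilinear morphisms of presheaves. -/
def Bilin (F₁ F₂ G : Dᵒᵖ ⥤ ModuleCat.{u} R) :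
    Submodule R (∀ X : Dᵒᵖ, (F₁.obj X) →ₗ[R] (F₂.obj X) →ₗ[R] (G.obj X)) where
  carrier := {φ | ∀ (X Y : Dᵒᵖ) (f : X ⟶ Y) (x : F₁.obj X) (y : F₂.obj X),
    (G.map f) (φ X x y) = φ Y ((F₁.map f) x) ((F₂.map f) y)}
  add_mem' := by
    intro a b ha hb X Y f x y
    simp [ha X Y f x y, hb X Y f x y]
  zero_mem' := by
    intro X Y f x y
    simp
  smul_mem' := by
    intro c a ha X Y f x y
    simp [ha X Y f x y]

/-- Pseudo-`R`-bilinear morphisms from presheaves of `R`-modules to a presheaf of abelian groups: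
biadditive, and scalars may be moved from one argument to the other. -/
structure PseudoBilin (F₁ F₂ : Dᵒᵖ ⥤ ModuleCat.{u} R) (G : Dᵒᵖ ⥤ AddCommGrpCat.{u}) where
  toFun : ∀ X : Dᵒᵖ, (F₁.obj X) →+ (F₂.obj X) →+ (G.obj X)
  natural : ∀ (X Y : Dᵒᵖ) (f : X ⟶ Y) (x : F₁.obj X) (y : F₂.obj X),
    (G.map f) (toFun X x y) = toFun Y ((F₁.map f) x) ((F₂.map f) y)
  balanced : ∀ (X : Dᵒᵖ) (a : R) (x : F₁.obj X) (y : F₂.obj X),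
    toFun X (a • x) y = toFun X x (a • y)

/-- Alternating pseudo-`R`-multilinear morphisms `F^n → G` from a presheaf of `R`-modules to a
presheaf of abelian groups: multilinear over `ℤ`, alternating, and scalars may be moved from one
argument to another. -/
structure PseudoAlt (F : Dᵒᵖ ⥤ ModuleCat.{u} R) (G : Dᵒᵖ ⥤ AddCommGrpCat.{u}) (n : ℕ) where
  toFun : ∀ X : Dᵒᵖ, (F.obj X) [⋀^Fin n]→ₗ[ℤ] (G.obj X)
  natural : ∀ (X Y : Dᵒᵖ) (f : X ⟶ Y) (x : Fin n → F.obj X),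
    (G.map f) (toFun X x) = toFun Y (fun i => (F.map f) (x i))
  balanced : ∀ (X : Dᵒᵖ) (a : R) (x : Fin n → F.obj X) (i j : Fin n),
    toFun X (Function.update x i (a • x i)) = toFun X (Function.update x j (a • x j))

/-- The underlying presheaf of abelian groups. -/
abbrev toAb (F : Dᵒᵖ ⥤ ModuleCat.{u} R) : Dᵒᵖ ⥤ AddCommGrpCat.{u} :=
  F ⋙ forget₂ (ModuleCat.{u} R) AddCommGrpCat.{u}

section Restriction

theorem append_update_left {B : Type u} {n m : ℕ} (x : Fin n → B) (y : Fin m → B) (i : Fin n) (a : B) :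
    Fin.append (Function.update x i a) y
      = Function.update (Fin.append x y) (Fin.castAdd m i) a := by
  funext k
  refine Fin.addCases (fun k => ?_) (fun k => ?_) k
  · by_cases h : k = i
    · subst h; simp
    · have h' : Fin.castAdd m k ≠ Fin.castAdd m i := fun e => h (Fin.castAdd_injective n m e)
      simp [h, h']
  · have h' : Fin.natAdd n k ≠ Fin.castAdd m i := by
      intro e
      have := congrArg Fin.val e
      have := i.isLt
      simp at *
      omega
    simp [h']

theorem append_update_right {B : Type u} {n m : ℕ} (x : Fin n → B) (y : Fin m → B) (j : Fin m) (a : B) :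
    Fin.append x (Function.update y j a)
      = Function.update (Fin.append x y) (Fin.natAdd n j) a := by
  funext k
  refine Fin.addCases (fun k => ?_) (fun k => ?_) k
  · have h' : Fin.castAdd m k ≠ Fin.natAdd n j := by
      intro e
      have := congrArg Fin.val e
      have := k.isLt
      simp at *
      omega
    simp [h']
  · by_cases h : k = j
    · subst h; simp
    · have h' : Fin.natAdd n k ≠ Fin.natAdd n j := fun e => h (Fin.natAdd_injective m n e)
      simp [h, h']

theorem comp_update {A B : Type u} {n : ℕ} (f : A → B) (x : Fin n → A) (i : Fin n) (a : A) :
    (fun k => f (Function.update x i a k)) = Function.update (fun k => f (x k)) i (f a) := by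
  funext k
  by_cases h : k = i
  · subst h; simp
  · simp [h]

variable {A B N : Type u} [AddCommGroup A] [Module R A] [AddCommGroup B] [Module R B]
  [AddCommGroup N] [Module R N]

/-- The map `(x, y) ↦ φ (f x₁, …, f x_n, y₁, …, y_m)`. -/
def splitAlt (f : A →ₗ[R] B) (n m : ℕ) (φ : B [⋀^Fin (n + m)]→ₗ[R] N) :
    A [⋀^Fin n]→ₗ[R] (B [⋀^Fin m]→ₗ[R] N) where
  toFun x :=
    { toFun := fun y => φ (Fin.append (fun i => f (x i)) y)
      map_update_add' := by
        intro inst y j a b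
        cases Subsingleton.elim inst (instDecidableEqFin m)
        simp only [append_update_right, φ.map_update_add]
      map_update_smul' := by
        intro inst y j c a
        cases Subsingleton.elim inst (instDecidableEqFin m)
        simp only [append_update_right, φ.map_update_smul]
      map_eq_zero_of_eq' := by
        intro y i j h hij
        refine φ.map_eq_zero_of_eq _ (i := Fin.natAdd n i) (j := Fin.natAdd n j) ?_ ?_
        · simpa using h
        · exact fun e => hij (Fin.natAdd_injective m n e) }
  map_update_add' := by
    intro inst x i a b
    cases Subsingleton.elim inst (instDecidableEqFin n)
    ext y
    change φ _ = φ _ + φ _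
    simp only [comp_update, append_update_left, map_add, φ.map_update_add]
  map_update_smul' := by
    intro inst x i c a
    cases Subsingleton.elim inst (instDecidableEqFin n)
    ext y
    change φ _ = c • φ _
    simp only [comp_update, append_update_left, map_smul, φ.map_update_smul]
  map_eq_zero_of_eq' := by
    intro x i j h hij
    ext y
    change φ _ = 0
    refine φ.map_eq_zero_of_eq _ (i := Fin.castAdd m i) (j := Fin.castAdd m j) ?_ ?_
    · simp [h]
    · exact fun e => hij (Fin.castAdd_injective n m e)

end Restriction

/-- Restriction `ρ : Alt^R(F₂^{n+m}, G) → Alt^R(F₁^n × F₂^m, G)` along `ι : F₁ → F₂`. -/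
def restrictAlt {F₁ F₂ : Dᵒᵖ ⥤ ModuleCat.{u} R} (ι : F₁ ⟶ F₂) (G : Dᵒᵖ ⥤ ModuleCat.{u} R)
    (n m : ℕ) : Alt F₂ G (n + m) →ₗ[R] BiAlt F₁ F₂ G n m where
  toFun φ := ⟨fun X => splitAlt (ι.app X).hom n m (φ.1 X), by
    intro X Y f x y
    change (G.map f) (φ.1 X _) = φ.1 Y _
    rw [φ.2 X Y f]
    congr 1
    funext k
    refine Fin.addCases (fun k => ?_) (fun k => ?_) k
    · simp
    · simp⟩
  map_add' _ _ := rfl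
  map_smul' _ _ := rfl

/-- Composition `π^* : Alt^R(F₁^n × F₃^m, G) → Alt^R(F₁^n × F₂^m, G)` with
`Id^n × π^m`, for `π : F₂ → F₃`. -/
def pullbackBiAlt (F₁ : Dᵒᵖ ⥤ ModuleCat.{u} R) {F₂ F₃ : Dᵒᵖ ⥤ ModuleCat.{u} R} (π : F₂ ⟶ F₃)
    (G : Dᵒᵖ ⥤ ModuleCat.{u} R) (n m : ℕ) : BiAlt F₁ F₃ G n m →ₗ[R] BiAlt F₁ F₂ G n m where
  toFun ψ := ⟨fun X =>
      ({ toFun := fun a => a.compLinearMap (π.app X).hom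
         map_add' := fun _ _ => rfl
         map_smul' := fun _ _ => rfl } :
        ((F₃.obj X) [⋀^Fin m]→ₗ[R] (G.obj X)) →ₗ[R]
          ((F₂.obj X) [⋀^Fin m]→ₗ[R] (G.obj X))).compAlternatingMap (ψ.1 X), by
    intro X Y f x y
    change (G.map f) (ψ.1 X x fun j => (π.app X) (y j))
      = ψ.1 Y (fun i => (F₁.map f) (x i)) (fun j => (π.app Y) ((F₂.map f) (y j)))
    rw [ψ.2 X Y f]
    congr 1
    funext j
    exact (NatTrans.naturality_apply π f (y j)).symm⟩
  map_add' _ _ := rfl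
  map_smul' _ _ := rfl

end Presheaves

/-! ### `R`-module schemes -/

section Schemes

/-- The property of a presheaf of `R`-modules on the category of `S`-schemes of being (represented
by) a scheme over `S`. -/
def isModuleScheme (R : Type v) [CommRing R] (S : Scheme.{u}) :
    ObjectProperty ((Over S)ᵒᵖ ⥤ ModuleCat.{u} R) :=
  fun F => (F ⋙ forget (ModuleCat.{u} R)).IsRepresentable

/-- The category of `R`-module schemes over `S` and `R`-linear homomorphisms: an `R`-module scheme
is given by its functor of points, a representable functor with values in `R`-modules. -/
abbrev ModuleScheme (R : Type v) [CommRing R] (S : Scheme.{u}) :=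
  (isModuleScheme.{u} R S).FullSubcategory

/-- The property of a presheaf of abelian groups of being (represented by) a scheme over `S`. -/
def isGroupScheme (S : Scheme.{u}) : ObjectProperty ((Over S)ᵒᵖ ⥤ AddCommGrpCat.{u}) :=
  fun F => (F ⋙ forget AddCommGrpCat.{u}).IsRepresentable

/-- Commutative group schemes over `S`. -/
abbrev GroupScheme (S : Scheme.{u}) := (isGroupScheme.{u} S).FullSubcategory

variable {R : Type v} [CommRing R] {S : Scheme.{u}}

/-- `0 → M₁ → M₂ → M₃ → 0` is exact as a sequence of sheaves for the fppf topology: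
`ι` is the kernel of `π`, and `π` is surjective locally for the fppf topology. -/
structure IsShortExact {M₁ M₂ M₃ : ModuleScheme.{u} R S} (ι : M₁ ⟶ M₂) (π : M₂ ⟶ M₃) : Prop where
  injective : ∀ X, Function.Injective (ι.hom.app X)
  exact : ∀ X, Function.Exact (ι.hom.app X) (π.hom.app X)
  locally_surjective :
    Presheaf.IsLocallySurjective (Scheme.fppfTopology.{u}.over S) π.hom

/-- `lam : M^n → E` is the universal alternating morphism, i.e. `E` is the `n`-th exterior power of
`M` over `R`. For `n > 0`: every alternating pseudo-`R`-multilinear morphism from `M^n` to a group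
scheme `G` factors uniquely through a homomorphism `E → G` (the `R`-module structure of `E` being
the one for which `lam` is `R`-multilinear). For `n = 0` this is the usual convention that `E`
represents `N ↦ Alt^R(M^0, N) = N(S)` on `R`-module schemes, i.e. `E` is the constant scheme `R`. -/
def IsExteriorPower (M E : ModuleScheme.{u} R S) (n : ℕ) (lam : Alt M.obj E.obj n) : Prop :=
  (n ≠ 0 → ∀ (G : GroupScheme.{u} S) (φ : PseudoAlt M.obj G.obj n),
    ∃! f : toAb E.obj ⟶ G.obj, ∀ X x, (f.app X) (lam.1 X x) = φ.toFun X x) ∧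
  (n = 0 → ∀ (N : ModuleScheme.{u} R S) (φ : Alt M.obj N.obj n),
    ∃! f : E ⟶ N, ∀ X x, (f.hom.app X) (lam.1 X x) = φ.1 X x)

/-- The `n`-th exterior power of `M` exists and is zero. -/
def ExteriorPowerIsZero (M : ModuleScheme.{u} R S) (n : ℕ) : Prop :=
  ∃ (E : ModuleScheme.{u} R S) (lam : Alt M.obj E.obj n),
    IsExteriorPower M E n lam ∧ ∀ X, Subsingleton (E.obj.obj X)

/-- `τ : M₁ × M₂ → T` is the universal bilinear morphism, i.e. `T` is the tensor product of `M₁`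
and `M₂` over `R` (with the `R`-module structure for which `τ` is `R`-bilinear). -/
def IsTensorProduct (M₁ M₂ T : ModuleScheme.{u} R S) (τ : Bilin M₁.obj M₂.obj T.obj) : Prop :=
  ∀ (G : GroupScheme.{u} S) (β : PseudoBilin M₁.obj M₂.obj G.obj),
    ∃! f : toAb T.obj ⟶ G.obj, ∀ X x y, (f.app X) (τ.1 X x y) = β.toFun X x y

/-- Base change `M_T`, as a presheaf on `T`-schemes. -/
abbrev baseChange (M : ModuleScheme.{u} R S) (T : Over S) : (Over T)ᵒᵖ ⥤ ModuleCat.{u} R :=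
  (Over.forget T).op ⋙ M.obj

/-- The inner module `T ↦ Mult^R_T(P_{1,T} × ⋯ × P_{r,T}, N_T)` is (represented by) an `R`-module
scheme over `S`; the transition maps of this functor are given by restriction. -/
def InnerMultExists {r : ℕ} (P : Fin r → ModuleScheme.{u} R S) (N : ModuleScheme.{u} R S) : Prop :=
  ∃ (Q : ModuleScheme.{u} R S)
    (e : ∀ T : Over S, Q.obj.obj (op T) ≃ₗ[R]
      Mult (fun i => baseChange (P i) T) (baseChange N T)),
    ∀ (T T' : Over S) (h : T' ⟶ T) (q : Q.obj.obj (op T)) (X : Over T')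
      (x : ∀ i, (P i).obj.obj (op X.left)),
      (e T' ((Q.obj.map h.op) q)).1 (op X) x = (e T q).1 (op ((Over.map h).obj X)) x

/-- The inner module `T ↦ Alt^R_T(P_T^r, N_T)` is (represented by) an `R`-module scheme over `S`. -/
def InnerAltExists (P : ModuleScheme.{u} R S) (r : ℕ) (N : ModuleScheme.{u} R S) : Prop :=
  ∃ (Q : ModuleScheme.{u} R S)
    (e : ∀ T : Over S, Q.obj.obj (op T) ≃ₗ[R] Alt (baseChange P T) (baseChange N T) r),
    ∀ (T T' : Over S) (h : T' ⟶ T) (q : Q.obj.obj (op T)) (X : Over T')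
      (x : Fin r → P.obj.obj (op X.left)),
      (e T' ((Q.obj.map h.op) q)).1 (op X) x = (e T q).1 (op ((Over.map h).obj X)) x

/-- The inner Hom `T ↦ Hom^R_T(P_T, N_T)` is (represented by) an `R`-module scheme over `S`. -/
def InnerHomExists (P N : ModuleScheme.{u} R S) : Prop :=
  InnerMultExists (fun _ : Fin 1 => P) N

/-- The inner modules `Mult^R(P₁ × ⋯ × P_r, N)` with all `P_i` among `M₁, M₂, M₃` and `r < n`
exist as `R`-module schemes over `S`. -/
def InnerMultsExist (M₁ M₂ M₃ : ModuleScheme.{u} R S) (n : ℕ) (N : ModuleScheme.{u} R S) : Prop :=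
  ∀ (r : ℕ), r < n → ∀ P : Fin r → ModuleScheme.{u} R S,
    (∀ i, P i = M₁ ∨ P i = M₂ ∨ P i = M₃) → InnerMultExists P N

end Schemes

end RModuleSchemes

/-! The engine is currying. Fixing all but `k` arguments of an alternating morphism φ : M₂ⁿ → N
gives an alternating morphism F^k → Q, where F → M₂ is any morphism and Q is the inner Mult of the
remaining factors with values in N. Admissibility makes Q a module scheme over S, so if ⋀^k F = 0
this morphism is zero already over S; exterior powers need not commute with base change. Hence φ
vanishes as soon as `k` of its arguments come from F (`alt_eq_zero_of_exteriorPowerIsZero`).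

For (b), take F = M₁ and k = n₁ + 1. The restriction ρ(φ) vanishes when one of its M₂-arguments lies
in ker π = M₁, so it is constant on the fibres of π. Since N is an fppf sheaf and π is locally
surjective, ρ(φ) descends to M₃.

For (a), suppose ρ(φ) = 0. Then φ vanishes once n₁ arguments lie in ker π, and this number is
lowered to 0 one by one (`alt_eq_zero_of_card_succ`). If a + 1 kernel arguments kill φ and only a <
n₁ are given, at least n₃ + 1 arguments remain. Currying n₃ + 1 of these gives an alternating
morphism M₂^{n₃+1} → Q which dies when an argument is in ker π. It descends to M₃^{n₃+1} and is zero
because ⋀^{n₃+1} M₃ = 0.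

For (c), T represents bialternating morphisms to N once the inner Alt and Hom exist
(`IsTensorProduct.existsUnique_hom_of_biAlt`), and ζ corresponds to μ(λ₂). A homomorphism f on
⋀^{n₂} M₂ is determined by f ∘ λ₂, hence by ρ(f ∘ λ₂) by (a), hence by f ∘ ζ.

For (d), let p be a retraction of ι. The wedge product of λ₁ ∘ p and λ₃ ∘ π induces a map ⋀^{n₂} M₂
→ T. On arguments (ιx, y) only the trivial shuffle survives since π ∘ ι = 0, so this map is a
retraction of ζ; cancelling ζ shows that it is an inverse. -/

namespace RModuleSchemes

/-! ### Represented inner functors and currying -/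

section InnerRep

variable {R : Type v} [CommRing R] {D : Type w₁} [Category.{w₂} D]

theorem presheaf_map_id (F : Dᵒᵖ ⥤ ModuleCat.{u} R) (X : Dᵒᵖ) (x : F.obj X) :
    F.map (𝟙 X) x = x := by
  simp

theorem presheaf_map_comp (F : Dᵒᵖ ⥤ ModuleCat.{u} R) {X Y Z : Dᵒᵖ} (f : X ⟶ Y) (g : Y ⟶ Z)
    (x : F.obj X) : F.map (f ≫ g) x = F.map g (F.map f x) := by
  simp

/-- `Q` represents the inner functor `T ↦ {natural maps W_T → N_T with values in V}`, where `V`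
is a class of maps (such as multilinear or alternating maps). -/
structure InnerRep (Q N : Dᵒᵖ ⥤ ModuleCat.{u} R) (W : Dᵒᵖ → Type u)
    (wmap : ∀ {X Y : Dᵒᵖ}, (X ⟶ Y) → W X → W Y) (V : ∀ X, Set (W X → N.obj X)) where
  ev : ∀ X, Q.obj X →ₗ[R] (W X → N.obj X)
  ev_mem : ∀ X q, ev X q ∈ V X
  natural : ∀ (X Y : Dᵒᵖ) (f : X ⟶ Y) (q : Q.obj X) (w : W X),
    N.map f (ev X q w) = ev Y (Q.map f q) (wmap f w)
  exists_eq : ∀ (T : Dᵒᵖ) (c : ∀ Y, (T ⟶ Y) → W Y → N.obj Y), (∀ Y f, c Y f ∈ V Y) →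
    (∀ (Y Z : Dᵒᵖ) (f : T ⟶ Y) (k : Y ⟶ Z) (w : W Y),
      N.map k (c Y f w) = c Z (f ≫ k) (wmap k w)) →
    ∃ q : Q.obj T, ∀ Y (f : T ⟶ Y), ev Y (Q.map f q) = c Y f
  ext : ∀ (T : Dᵒᵖ) (q q' : Q.obj T),
    (∀ Y (f : T ⟶ Y), ev Y (Q.map f q) = ev Y (Q.map f q')) → q = q'

namespace InnerRep

variable {Q N : Dᵒᵖ ⥤ ModuleCat.{u} R} {W : Dᵒᵖ → Type u}
  {wmap : ∀ {X Y : Dᵒᵖ}, (X ⟶ Y) → W X → W Y} {V : ∀ X, Set (W X → N.obj X)}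
  (rep : InnerRep Q N W wmap V)

/-- This is currying: for u over X, the maps `g Y (umap f u)`, for f : X ⟶ Y, form a natural family
on the base changes of X and so come from one element of Q(X). Uniqueness of that element gives
naturality. -/
theorem exists_lift {U : Dᵒᵖ → Type*} (umap : ∀ {X Y : Dᵒᵖ}, (X ⟶ Y) → U X → U Y)
    (umap_id : ∀ X (u : U X), umap (𝟙 X) u = u)
    (umap_comp : ∀ {X Y Z : Dᵒᵖ} (f : X ⟶ Y) (g : Y ⟶ Z) (u : U X),
      umap (f ≫ g) u = umap g (umap f u))
    (g : ∀ X, U X → W X → N.obj X) (hV : ∀ X u, g X u ∈ V X)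
    (hg : ∀ (X Y : Dᵒᵖ) (f : X ⟶ Y) (u : U X) (w : W X),
      N.map f (g X u w) = g Y (umap f u) (wmap f w)) :
    ∃ G : ∀ X, U X → Q.obj X, (∀ X u, rep.ev X (G X u) = g X u) ∧
      ∀ (X Y : Dᵒᵖ) (f : X ⟶ Y) (u : U X), Q.map f (G X u) = G Y (umap f u) := by
  have key : ∀ X (u : U X), ∃ q : Q.obj X, ∀ Y (f : X ⟶ Y),
      rep.ev Y (Q.map f q) = g Y (umap f u) := fun X u =>
    rep.exists_eq X (fun Y f => g Y (umap f u)) (fun Y f => hV _ _) (fun Y Z f k w => by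
      rw [hg, umap_comp])
  choose G hG using key
  refine ⟨G, fun X u => ?_, fun X Y f u => rep.ext _ _ _ fun Z k => ?_⟩
  · have := hG X u X (𝟙 X)
    rwa [presheaf_map_id, umap_id] at this
  · rw [← presheaf_map_comp, hG, hG, umap_comp]

/-- Equations in Q can be tested after base change and evaluation at each w, so the curried map is
alternating once `g` is so for every fixed w. -/
theorem exists_alt {M : Dᵒᵖ ⥤ ModuleCat.{u} R} {n : ℕ}
    (g : ∀ X, (Fin n → M.obj X) → W X → N.obj X) (hV : ∀ X x, g X x ∈ V X)
    (hg : ∀ (X Y : Dᵒᵖ) (f : X ⟶ Y) (x : Fin n → M.obj X) (w : W X),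
      N.map f (g X x w) = g Y (fun i => M.map f (x i)) (wmap f w))
    (halt : ∀ X w, ∃ φ : (M.obj X) [⋀^Fin n]→ₗ[R] (N.obj X), ∀ x, φ x = g X x w) :
    ∃ G : Alt M Q n, ∀ X x, rep.ev X (G.1 X x) = g X x := by
  obtain ⟨G, hG, hnat⟩ := rep.exists_lift (U := fun X => Fin n → M.obj X)
    (fun f x i => M.map f (x i)) (fun X u => by simp) (fun f g u => by simp) g hV hg
  have ext' : ∀ X x (q : Q.obj X), (∀ Y (f : X ⟶ Y) w,
      g Y (fun i => M.map f (x i)) w = rep.ev Y (Q.map f q) w) → G X x = q := fun X x q h =>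
    rep.ext _ _ _ fun Y f => by
      rw [hnat, hG]; exact funext fun w => h Y f w
  refine ⟨⟨fun X =>
    { toFun := G X
      map_update_add' := ?_
      map_update_smul' := ?_
      map_eq_zero_of_eq' := ?_ }, fun X Y f x => hnat X Y f x⟩, fun X x => hG X x⟩
  · intro inst x i a b
    cases Subsingleton.elim inst (instDecidableEqFin n)
    refine ext' _ _ _ fun Y f w => ?_
    obtain ⟨φ, hφ⟩ := halt Y w
    simp only [map_add, hnat, hG, Pi.add_apply, ← hφ, comp_update, φ.map_update_add]
  · intro inst x i a b
    cases Subsingleton.elim inst (instDecidableEqFin n)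
    refine ext' _ _ _ fun Y f w => ?_
    obtain ⟨φ, hφ⟩ := halt Y w
    simp only [map_smul, hnat, hG, Pi.smul_apply, ← hφ, comp_update, φ.map_update_smul]
  · intro x i j h hij
    refine ext' _ _ _ fun Y f w => ?_
    obtain ⟨φ, hφ⟩ := halt Y w
    rw [← hφ, map_zero, map_zero]
    exact φ.map_eq_zero_of_eq _ (by rw [h]) hij

theorem exists_hom {E : Dᵒᵖ ⥤ ModuleCat.{u} R}
    (g : ∀ X, E.obj X → W X → N.obj X) (hV : ∀ X x, g X x ∈ V X)
    (hg : ∀ (X Y : Dᵒᵖ) (f : X ⟶ Y) (x : E.obj X) (w : W X),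
      N.map f (g X x w) = g Y (E.map f x) (wmap f w))
    (hlin : ∀ X w, ∃ φ : (E.obj X) →ₗ[R] (N.obj X), ∀ x, φ x = g X x w) :
    ∃ G : E ⟶ Q, ∀ X x, rep.ev X (G.app X x) = g X x := by
  obtain ⟨G, hG, hnat⟩ := rep.exists_lift (U := fun X => E.obj X)
    (fun f x => E.map f x) (fun X u => by simp) (fun f g u => by simp) g hV hg
  have ext' : ∀ X x (q : Q.obj X), (∀ Y (f : X ⟶ Y) w,
      g Y (E.map f x) w = rep.ev Y (Q.map f q) w) → G X x = q := fun X x q h =>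
    rep.ext _ _ _ fun Y f => by
      rw [hnat, hG]; exact funext fun w => h Y f w
  refine ⟨{ app := fun X => ModuleCat.ofHom
              { toFun := G X
                map_add' := ?_
                map_smul' := ?_ }
            naturality := ?_ }, fun X x => hG X x⟩
  · intro a b
    refine ext' _ _ _ fun Y f w => ?_
    obtain ⟨φ, hφ⟩ := hlin Y w
    simp only [map_add, hnat, hG, Pi.add_apply, ← hφ]
  · intro a b
    refine ext' _ _ _ fun Y f w => ?_
    obtain ⟨φ, hφ⟩ := hlin Y w
    simp only [map_smul, hnat, hG, Pi.smul_apply, ← hφ, RingHom.id_apply]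
  · intro X Y f
    ext x
    exact (hnat X Y f x).symm

end InnerRep

/-- An `R`-multilinear alternating morphism is pseudo-`R`-multilinear. -/
def toPseudoAlt {F G : Dᵒᵖ ⥤ ModuleCat.{u} R} {n : ℕ} (φ : Alt F G n) :
    PseudoAlt F (toAb G) n where
  toFun X :=
    { toFun := fun x => φ.1 X x
      map_update_add' := fun {_} x i a b => (φ.1 X).map_update_add' x i a b
      map_update_smul' := fun {_} x i c a => by
        change φ.1 X _ = (c • φ.1 X (Function.update x i a) : G.obj X)
        exact map_zsmul (((φ.1 X).toMultilinearMap.toLinearMap x i).toAddMonoidHom) c a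
      map_eq_zero_of_eq' := (φ.1 X).map_eq_zero_of_eq' }
  natural X Y f x := φ.2 X Y f x
  balanced X a x i j := by
    change φ.1 X _ = φ.1 X _
    simp [(φ.1 X).map_update_smul]

/-- An `R`-bilinear morphism is pseudo-`R`-bilinear. -/
def toPseudoBilin {F₁ F₂ G : Dᵒᵖ ⥤ ModuleCat.{u} R} (φ : Bilin F₁ F₂ G) :
    PseudoBilin F₁ F₂ (toAb G) where
  toFun X := AddMonoidHom.mk' (fun x => (φ.1 X x).toAddMonoidHom) (fun a b => by
    ext y
    change φ.1 X (a + b) y = φ.1 X a y + φ.1 X b y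
    simp)
  natural X Y f x y := φ.2 X Y f x y
  balanced X a x y := by
    change φ.1 X (a • x) y = φ.1 X x (a • y)
    simp

/-- The endomorphism of the underlying presheaf of abelian groups given by a scalar. -/
def scalarHom (F : Dᵒᵖ ⥤ ModuleCat.{u} R) (a : R) : toAb F ⟶ toAb F where
  app X := AddCommGrpCat.ofHom (DistribSMul.toAddMonoidHom (F.obj X) a)
  naturality X Y f := by
    ext x
    exact ((F.map f).hom.map_smul a x).symm

/-- A morphism of presheaves of abelian groups commuting with scalars is a morphism of presheaves
of modules. -/
def linearOfScalarHom {F G : Dᵒᵖ ⥤ ModuleCat.{u} R} (f : toAb F ⟶ toAb G)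
    (hf : ∀ a, scalarHom F a ≫ f = f ≫ scalarHom G a) : F ⟶ G where
  app X := ModuleCat.ofHom
    { toFun := fun x => f.app X x
      map_add' := fun a b => (f.app X).hom.map_add a b
      map_smul' := fun a x => ConcreteCategory.congr_hom (NatTrans.congr_app (hf a) X) x }
  naturality X Y k := by
    ext x
    exact NatTrans.naturality_apply f k x

end InnerRep

/-! ### From universality for group schemes to universality for module schemes -/

section Universal

variable {R : Type v} [CommRing R] {S : Scheme.{u}}

/-- The commutative group scheme underlying a module scheme. -/
def ModuleScheme.toGroupScheme (N : ModuleScheme.{u} R S) : GroupScheme S :=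
  ⟨toAb N.obj, N.property⟩

/-- Universality among group schemes only yields an additive f. It is R-linear by uniqueness: f ∘ a
and a ∘ f both factor the morphism aφ. -/
theorem IsExteriorPower.existsUnique_hom {M E : ModuleScheme.{u} R S} {n : ℕ}
    {lam : Alt M.obj E.obj n} (hE : IsExteriorPower M E n lam) (N : ModuleScheme.{u} R S)
    (φ : Alt M.obj N.obj n) :
    ∃! f : E ⟶ N, ∀ X x, f.hom.app X (lam.1 X x) = φ.1 X x := by
  by_cases hn : n = 0
  · exact hE.2 hn N φ
  obtain ⟨f, hf, hu⟩ := hE.1 hn N.toGroupScheme (toPseudoAlt φ)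
  have hlin : ∀ a, scalarHom E.obj a ≫ f = f ≫ scalarHom N.obj a := fun a => by
    refine (hE.1 hn N.toGroupScheme (toPseudoAlt (a • φ))).unique (fun X x => ?_) (fun X x => ?_)
    · change f.app X (a • lam.1 X x) = a • φ.1 X x
      -- A scalar is moved through `lam` and `φ` by absorbing it into one argument; this is where n
      -- ≠ 0 is needed.
      let i : Fin n := ⟨0, Nat.pos_of_ne_zero hn⟩
      have h1 := (lam.1 X).map_update_smul x i a (x i)
      have h2 := (φ.1 X).map_update_smul x i a (x i)
      rw [Function.update_eq_self] at h1 h2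
      rw [← h1, ← h2]
      exact hf X _
    · change a • (show N.obj.obj X from f.app X (lam.1 X x)) = a • φ.1 X x
      exact congrArg (fun z : N.obj.obj X => a • z) (hf X x)
  refine ⟨ObjectProperty.homMk (linearOfScalarHom f hlin), fun X x => hf X x, fun g hg => ?_⟩
  have := hu (Functor.whiskerRight g.hom (forget₂ (ModuleCat.{u} R) AddCommGrpCat.{u}))
    (fun X x => hg X x)
  ext X x
  exact ConcreteCategory.congr_hom (NatTrans.congr_app this X) x

theorem IsTensorProduct.existsUnique_hom {M₁ M₂ T : ModuleScheme.{u} R S}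
    {τ : Bilin M₁.obj M₂.obj T.obj} (hT : IsTensorProduct M₁ M₂ T τ) (N : ModuleScheme.{u} R S)
    (β : Bilin M₁.obj M₂.obj N.obj) :
    ∃! f : T ⟶ N, ∀ X x y, f.hom.app X (τ.1 X x y) = β.1 X x y := by
  obtain ⟨f, hf, hu⟩ := hT N.toGroupScheme (toPseudoBilin β)
  have hlin : ∀ a, scalarHom T.obj a ≫ f = f ≫ scalarHom N.obj a := fun a => by
    refine (hT N.toGroupScheme (toPseudoBilin (a • β))).unique (fun X x y => ?_) (fun X x y => ?_)
    · change f.app X (a • τ.1 X x y) = a • β.1 X x y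
      have h1 := (τ.1 X x).map_smul a y
      have h2 := (β.1 X x).map_smul a y
      rw [← h1, ← h2]
      exact hf X _ _
    · change a • (show N.obj.obj X from f.app X (τ.1 X x y)) = a • β.1 X x y
      exact congrArg (fun z : N.obj.obj X => a • z) (hf X x y)
  refine ⟨ObjectProperty.homMk (linearOfScalarHom f hlin), fun X x => hf X x, fun g hg => ?_⟩
  have := hu (Functor.whiskerRight g.hom (forget₂ (ModuleCat.{u} R) AddCommGrpCat.{u}))
    (fun X x => hg X x)
  ext X x
  exact ConcreteCategory.congr_hom (NatTrans.congr_app this X) x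

end Universal

/-! ### Inner functors defined by base change are represented inner functors -/

section InnerExistence

variable {R : Type v} [CommRing R] {S : Scheme.{u}}

/-- Maps that are `R`-multilinear. -/
def multilinearMaps {r : ℕ} (P : Fin r → Type u) [∀ i, AddCommGroup (P i)] [∀ i, Module R (P i)]
    (N : Type u) [AddCommGroup N] [Module R N] : Set ((∀ i, P i) → N) :=
  {f | ∃ φ : MultilinearMap R P N, ⇑φ = f}

/-- Maps that are `R`-multilinear and alternating. -/
def alternatingMaps (R : Type v) [CommRing R] (n : ℕ) (P : Type u) [AddCommGroup P] [Module R P]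
    (N : Type u) [AddCommGroup N] [Module R N] : Set ((Fin n → P) → N) :=
  {f | ∃ φ : P [⋀^Fin n]→ₗ[R] N, ⇑φ = f}

/-- An inner functor given on all `T` over `S` by natural maps of presheaves on `T`-schemes is
determined by its values at the identities. -/
noncomputable def innerRepOfOver (Q N : (Over S)ᵒᵖ ⥤ ModuleCat.{u} R) (W : (Over S)ᵒᵖ → Type u)
    (wmap : ∀ {X Y : (Over S)ᵒᵖ}, (X ⟶ Y) → W X → W Y) (V : ∀ X, Set (W X → N.obj X))
    (wmap_id : ∀ X (w : W X), wmap (𝟙 X) w = w)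
    (Ev : ∀ T : Over S, Q.obj (op T) →ₗ[R] (∀ X : Over T, W (op X.left) → N.obj (op X.left)))
    (hV : ∀ T q X, Ev T q X ∈ V (op X.left))
    (hnat : ∀ T q {X Y : Over T} (f : Y ⟶ X) (w : W (op X.left)),
      N.map f.left.op (Ev T q X w) = Ev T q Y (wmap f.left.op w))
    (hinj : ∀ T, Function.Injective (Ev T))
    (hsurj : ∀ T (c : ∀ X : Over T, W (op X.left) → N.obj (op X.left)),
      (∀ X, c X ∈ V (op X.left)) →
      (∀ {X Y : Over T} (f : Y ⟶ X) (w : W (op X.left)),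
        N.map f.left.op (c X w) = c Y (wmap f.left.op w)) → ∃ q, Ev T q = c)
    (hbc : ∀ (T T' : Over S) (h : T' ⟶ T) (q : Q.obj (op T)) (X : Over T') (w : W (op X.left)),
      Ev T' (Q.map h.op q) X w = Ev T q ((Over.map h).obj X) w) :
    InnerRep Q N W wmap V := by
  -- The value of q at the T-scheme T' is the value of its restriction to T' at the identity of T'.
  -- Evaluation at identities therefore carries all the information.
  have key : ∀ (T T' : Over S) (h : T' ⟶ T) (q : Q.obj (op T)) (w : W (op T')),
      Ev T' (Q.map h.op q) (Over.mk (𝟙 T')) w = Ev T q (Over.mk h) w := fun T T' h q w => by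
    rw [hbc]
    -- The two objects over T have structure maps h and 𝟙 ≫ h; `f` is the identity on underlying
    -- schemes, so naturality along it identifies the two values.
    let f : Over.mk h ⟶ (Over.map h).obj (Over.mk (𝟙 T')) := Over.homMk (𝟙 T') (by simp)
    have := hnat T q f w
    have e : f.left.op = 𝟙 (op T') := rfl
    rw [e] at this
    rw [show wmap (𝟙 (op T')) w = w from wmap_id _ w] at this
    rw [← this]
    exact (presheaf_map_id N _ _).symm
  have keyX : ∀ (T : Over S) (q : Q.obj (op T)) (X : Over T) (w : W (op X.left)),
      Ev X.left (Q.map X.hom.op q) (Over.mk (𝟙 X.left)) w = Ev T q X w :=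
    fun T q X w => key T X.left X.hom q w
  refine
    { ev := fun X =>
        { toFun := fun q => Ev X.unop q (Over.mk (𝟙 X.unop))
          map_add' := fun a b => by rw [map_add]; rfl
          map_smul' := fun a b => by rw [map_smul]; rfl }
      ev_mem := fun X q => hV X.unop q (Over.mk (𝟙 X.unop))
      natural := fun X Y f q w => ?_
      exists_eq := fun T c hc hcn => ?_
      ext := fun T q q' h => ?_ }
  · change N.map f (Ev X.unop q (Over.mk (𝟙 X.unop)) w)
      = Ev Y.unop (Q.map f q) (Over.mk (𝟙 Y.unop)) (wmap f w)
    have h1 := key X.unop Y.unop f.unop q (wmap f w)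
    have h2 := hnat X.unop q
      (Over.homMk f.unop (by simp) : Over.mk f.unop ⟶ Over.mk (𝟙 X.unop)) w
    exact h2.trans h1.symm
  · obtain ⟨q, hq⟩ := hsurj T.unop (fun X => c (op X.left) X.hom.op) (fun X => hc _ _)
      (fun {X Y} f w => by
        rw [hcn]
        congr 1
        exact congrArg Quiver.Hom.op (Over.w f))
    refine ⟨q, fun Y f => funext fun w => ?_⟩
    change Ev Y.unop (Q.map f q) (Over.mk (𝟙 Y.unop)) w = _
    refine (key T.unop Y.unop f.unop q w).trans ?_
    rw [hq]
    rfl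
  · refine hinj T.unop (funext fun X => funext fun w => ?_)
    rw [← keyX T.unop q X w, ← keyX T.unop q' X w]
    exact congrFun (h (op X.left) X.hom.op) w

theorem InnerMultExists.exists_rep {r : ℕ} {P : Fin r → ModuleScheme.{u} R S}
    {N : ModuleScheme.{u} R S} (h : InnerMultExists P N) :
    ∃ Q : ModuleScheme.{u} R S, Nonempty (InnerRep Q.obj N.obj (fun X => ∀ i, (P i).obj.obj X)
      (fun f x i => (P i).obj.map f (x i))
      (fun X => multilinearMaps (R := R) (fun i => (P i).obj.obj X) (N.obj.obj X))) := by
  obtain ⟨Q, e, he⟩ := h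
  refine ⟨Q, ⟨innerRepOfOver _ _ _ _ _ (fun X w => by simp)
    (fun T =>
      { toFun := fun q X => (e T q).1 (op X)
        map_add' := fun a b => by rw [map_add]; rfl
        map_smul' := fun a b => by rw [map_smul]; rfl })
    (fun T q X => ⟨(e T q).1 (op X), rfl⟩)
    (fun T q {X Y} f w => (e T q).2 (op X) (op Y) f.op w)
    (fun T q q' h => ?_) (fun T c hc hn => ?_) (fun T T' h q X w => he T T' h q X w)⟩⟩
  · refine (e T).injective (Subtype.ext (funext fun X => DFunLike.coe_injective ?_))
    exact congrFun h X.unop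
  · choose φ hφ using hc
    refine ⟨(e T).symm ⟨fun X => φ X.unop, fun X Y f w => ?_⟩, funext fun X => ?_⟩
    · have := hn f.unop w
      rw [← hφ, ← hφ] at this
      exact this
    · change ⇑((e T ((e T).symm _)).1 (op X)) = _
      rw [LinearEquiv.apply_symm_apply]
      exact hφ X

theorem InnerAltExists.exists_rep {r : ℕ} {P N : ModuleScheme.{u} R S}
    (h : InnerAltExists P r N) :
    ∃ Q : ModuleScheme.{u} R S, Nonempty (InnerRep Q.obj N.obj (fun X => Fin r → P.obj.obj X)
      (fun f x i => P.obj.map f (x i))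
      (fun X => alternatingMaps R r (P.obj.obj X) (N.obj.obj X))) := by
  obtain ⟨Q, e, he⟩ := h
  refine ⟨Q, ⟨innerRepOfOver _ _ _ _ _ (fun X w => by simp)
    (fun T =>
      { toFun := fun q X => (e T q).1 (op X)
        map_add' := fun a b => by rw [map_add]; rfl
        map_smul' := fun a b => by rw [map_smul]; rfl })
    (fun T q X => ⟨(e T q).1 (op X), rfl⟩)
    (fun T q {X Y} f w => (e T q).2 (op X) (op Y) f.op w)
    (fun T q q' h => ?_) (fun T c hc hn => ?_) (fun T T' h q X w => he T T' h q X w)⟩⟩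
  · refine (e T).injective (Subtype.ext (funext fun X => DFunLike.coe_injective ?_))
    exact congrFun h X.unop
  · choose φ hφ using hc
    refine ⟨(e T).symm ⟨fun X => φ X.unop, fun X Y f w => ?_⟩, funext fun X => ?_⟩
    · have := hn f.unop w
      rw [← hφ, ← hφ] at this
      exact this
    · change ⇑((e T ((e T).symm _)).1 (op X)) = _
      rw [LinearEquiv.apply_symm_apply]
      exact hφ X

end InnerExistence

/-! ### Extending families of maps to exterior powers -/

section Extension

variable {R : Type v} [CommRing R] {S : Scheme.{u}}

theorem ExteriorPowerIsZero.alt_eq_zero {M : ModuleScheme.{u} R S} {n : ℕ}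
    (h : ExteriorPowerIsZero M n) {Q : ModuleScheme.{u} R S} (G : Alt M.obj Q.obj n) : G = 0 := by
  obtain ⟨E, lam, hE, h0⟩ := h
  obtain ⟨f, hf, -⟩ := hE.existsUnique_hom Q G
  refine Subtype.ext (funext fun X => AlternatingMap.ext fun x => ?_)
  rw [← hf X x, (h0 X).elim (lam.1 X x) 0]
  exact map_zero _

section

variable {Q N : ModuleScheme.{u} R S} {W : (Over S)ᵒᵖ → Type u}
  {wmap : ∀ {X Y : (Over S)ᵒᵖ}, (X ⟶ Y) → W X → W Y} {V : ∀ X, Set (W X → N.obj.obj X)}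

/-- Two families of maps that are linear in a variable from an exterior power `E` agree if they
agree on the image of the universal alternating morphism. -/
theorem IsExteriorPower.family_ext (rep : InnerRep Q.obj N.obj W wmap V)
    {M E : ModuleScheme.{u} R S} {n : ℕ} {lam : Alt M.obj E.obj n}
    (hE : IsExteriorPower M E n lam) (g g' : ∀ X, E.obj.obj X → W X → N.obj.obj X)
    (hV : ∀ X e, g X e ∈ V X) (hV' : ∀ X e, g' X e ∈ V X)
    (hg : ∀ (X Y : (Over S)ᵒᵖ) (f : X ⟶ Y) (e : E.obj.obj X) (w : W X),
      N.obj.map f (g X e w) = g Y (E.obj.map f e) (wmap f w))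
    (hg' : ∀ (X Y : (Over S)ᵒᵖ) (f : X ⟶ Y) (e : E.obj.obj X) (w : W X),
      N.obj.map f (g' X e w) = g' Y (E.obj.map f e) (wmap f w))
    (hlin : ∀ X w, ∃ φ : (E.obj.obj X) →ₗ[R] (N.obj.obj X), ∀ x, φ x = g X x w)
    (hlin' : ∀ X w, ∃ φ : (E.obj.obj X) →ₗ[R] (N.obj.obj X), ∀ x, φ x = g' X x w)
    (h : ∀ X x w, g X (lam.1 X x) w = g' X (lam.1 X x) w) : g = g' := by
  obtain ⟨G, hG⟩ := rep.exists_hom g hV hg hlin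
  obtain ⟨G', hG'⟩ := rep.exists_hom g' hV' hg' hlin'
  let φ : Alt M.obj Q.obj n := ⟨fun X => (G.app X).hom.compAlternatingMap (lam.1 X),
    fun X Y f x => by
      change Q.obj.map f (G.app X (lam.1 X x)) = G.app Y (lam.1 Y _)
      rw [← lam.2, NatTrans.naturality_apply]⟩
  have e : (ObjectProperty.homMk G : E ⟶ Q) = ObjectProperty.homMk G' := by
    refine (hE.existsUnique_hom Q φ).unique (fun X x => rfl) (fun X x => ?_)
    change G'.app X (lam.1 X x) = G.app X (lam.1 X x)
    refine rep.ext _ _ _ fun Y f => ?_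
    rw [← NatTrans.naturality_apply, ← NatTrans.naturality_apply, lam.2 X Y f, hG, hG']
    exact funext fun w => (h Y _ w).symm
  have e' : G = G' := congrArg (fun k => k.hom) e
  funext X x
  rw [← hG, ← hG', e']

/-- A family of maps that is alternating in a variable from `M^n` extends to a family that is
linear in a variable from the exterior power. -/
theorem IsExteriorPower.exists_family (rep : InnerRep Q.obj N.obj W wmap V)
    {M E : ModuleScheme.{u} R S} {n : ℕ} {lam : Alt M.obj E.obj n}
    (hE : IsExteriorPower M E n lam) (g : ∀ X, (Fin n → M.obj.obj X) → W X → N.obj.obj X)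
    (hV : ∀ X x, g X x ∈ V X)
    (hg : ∀ (X Y : (Over S)ᵒᵖ) (f : X ⟶ Y) (x : Fin n → M.obj.obj X) (w : W X),
      N.obj.map f (g X x w) = g Y (fun i => M.obj.map f (x i)) (wmap f w))
    (halt : ∀ X w, ∃ φ : (M.obj.obj X) [⋀^Fin n]→ₗ[R] (N.obj.obj X), ∀ x, φ x = g X x w) :
    ∃ k : ∀ X, E.obj.obj X →ₗ[R] (W X → N.obj.obj X), (∀ X e, k X e ∈ V X) ∧
      (∀ (X Y : (Over S)ᵒᵖ) (f : X ⟶ Y) (e : E.obj.obj X) (w : W X),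
        N.obj.map f (k X e w) = k Y (E.obj.map f e) (wmap f w)) ∧
      ∀ X x, k X (lam.1 X x) = g X x := by
  obtain ⟨G, hG⟩ := rep.exists_alt g hV hg halt
  obtain ⟨f, hf, -⟩ := hE.existsUnique_hom Q G
  refine ⟨fun X => rep.ev X ∘ₗ (f.hom.app X).hom, fun X e => rep.ev_mem _ _, fun X Y k e w => ?_,
    fun X x => ?_⟩
  · change N.obj.map k (rep.ev X (f.hom.app X e) w) = rep.ev Y (f.hom.app Y (E.obj.map k e)) _
    rw [rep.natural, NatTrans.naturality_apply]
  · change rep.ev X (f.hom.app X (lam.1 X x)) = _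
    rw [hf, hG]

end

/-! ### Bialternating morphisms and tensor products of exterior powers -/

section TensorOfExteriorPowers

variable {M₁ M₃ E₁ E₃ T N : ModuleScheme.{u} R S} {n₁ n₃ : ℕ}
  {lam₁ : Alt M₁.obj E₁.obj n₁} {lam₃ : Alt M₃.obj E₃.obj n₃} {τ : Bilin E₁.obj E₃.obj T.obj}

/-- The tensor product of two exterior powers has the universal property for bialternating
morphisms to `N`, provided that suitable inner functors exist. -/
theorem IsTensorProduct.existsUnique_hom_of_biAlt (h₁ : IsExteriorPower M₁ E₁ n₁ lam₁)
    (h₃ : IsExteriorPower M₃ E₃ n₃ lam₃) (hT : IsTensorProduct E₁ E₃ T τ)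
    (hA : InnerAltExists M₃ n₃ N) (hH : InnerHomExists E₁ N) (β : BiAlt M₁.obj M₃.obj N.obj n₁ n₃) :
    ∃! f : T ⟶ N, ∀ X x z, f.hom.app X (τ.1 X (lam₁.1 X x) (lam₃.1 X z)) = β.1 X x z := by
  obtain ⟨QA, ⟨repA⟩⟩ := hA.exists_rep
  obtain ⟨QH, ⟨repH⟩⟩ := hH.exists_rep
  refine existsUnique_of_exists_of_unique ?_ ?_
  -- View β as M₁^{n₁} → Alt(M₃^{n₃}, N) and extend it to E₁. Then flip the result to M₃^{n₃} →
  -- Hom(E₁, N) and extend it to E₃.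
  · obtain ⟨k, kV, knat, klam⟩ := h₁.exists_family repA (fun X x z => β.1 X x z)
      (fun X x => ⟨β.1 X x, rfl⟩) (fun X Y f x z => β.2 X Y f x z)
      (fun X z => ⟨(LinearMap.compAlternatingMap
        { toFun := fun ψ => ψ z
          map_add' := fun _ _ => rfl
          map_smul' := fun _ _ => rfl } (β.1 X)), fun x => rfl⟩)
    obtain ⟨l, lV, lnat, llam⟩ := h₃.exists_family repH (fun X z e => k X (e 0) z)
      (fun X z => ⟨MultilinearMap.ofSubsingleton R _ _ 0 (LinearMap.proj z ∘ₗ k X), rfl⟩)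
      (fun X Y f z e => knat X Y f (e 0) z)
      (fun X e => by
        obtain ⟨φ, hφ⟩ := kV X (e 0)
        exact ⟨φ, fun z => congrFun hφ z⟩)
    have lin1 : ∀ X c, ∃ φ : E₁.obj.obj X →ₗ[R] N.obj.obj X, ∀ e, φ e = l X c (fun _ => e) := by
      intro X c
      obtain ⟨φ, hφ⟩ := lV X c
      exact ⟨(MultilinearMap.ofSubsingleton R _ _ 0).symm φ, fun e => congrFun hφ _⟩
    choose φ hφ using lin1
    let b : Bilin E₁.obj E₃.obj N.obj := ⟨fun X => LinearMap.mk₂ R (fun e c => φ X c e)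
      (fun _ _ _ => map_add _ _ _) (fun _ _ _ => map_smul _ _ _)
      (fun e c c' => by simp [hφ]) (fun a e c => by simp [hφ]),
      fun X Y f e c => by
        change N.obj.map f (φ X c e) = φ Y _ _
        rw [hφ, hφ, lnat]⟩
    obtain ⟨f, hf, -⟩ := hT.existsUnique_hom N b
    refine ⟨f, fun X x z => ?_⟩
    rw [hf]
    change φ X _ _ = _
    rw [hφ, llam]
    exact congrFun (klam X x) z
  · intro f f' hf hf'
    let b : (T ⟶ N) → ∀ X, E₁.obj.obj X →ₗ[R] E₃.obj.obj X →ₗ[R] N.obj.obj X := fun f X =>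
      (τ.1 X).compr₂ (f.hom.app X).hom
    have bnat : ∀ (f : T ⟶ N) (X Y : (Over S)ᵒᵖ) (k : X ⟶ Y) (e : E₁.obj.obj X) (c : E₃.obj.obj X),
        N.obj.map k (b f X e c) = b f Y (E₁.obj.map k e) (E₃.obj.map k c) := by
      intro f X Y k e c
      change N.obj.map k (f.hom.app X (τ.1 X e c)) = f.hom.app Y (τ.1 Y _ _)
      rw [← τ.2, NatTrans.naturality_apply]
    -- Uniqueness follows the same order: agreement on λ₁ × λ₃ gives agreement on E₁ × λ₃, and then
    -- in `key2` on E₁ × E₃.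
    have key1 : (fun X (e : E₁.obj.obj X) (z : Fin n₃ → M₃.obj.obj X) => b f X e (lam₃.1 X z))
        = fun X e z => b f' X e (lam₃.1 X z) := by
      have nat' : ∀ (f : T ⟶ N) (X Y : (Over S)ᵒᵖ) (k : X ⟶ Y) (e : E₁.obj.obj X)
          (z : Fin n₃ → M₃.obj.obj X), N.obj.map k (b f X e (lam₃.1 X z))
            = b f Y (E₁.obj.map k e) (lam₃.1 Y fun i => M₃.obj.map k (z i)) := by
        intro f X Y k e z
        rw [bnat, lam₃.2]
      refine h₁.family_ext repA _ _ (fun X e => ⟨(b f X e).compAlternatingMap (lam₃.1 X), rfl⟩)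
        (fun X e => ⟨(b f' X e).compAlternatingMap (lam₃.1 X), rfl⟩)
        (nat' f) (nat' f') (fun X z => ⟨(b f X).flip (lam₃.1 X z), fun _ => rfl⟩)
        (fun X z => ⟨(b f' X).flip (lam₃.1 X z), fun _ => rfl⟩)
        (fun X x z => (hf X x z).trans (hf' X x z).symm)
    have key2 : (fun X (c : E₃.obj.obj X) (e : Fin 1 → E₁.obj.obj X) => b f X (e 0) c)
        = fun X c e => b f' X (e 0) c := by
      refine h₃.family_ext repH _ _
        (fun X c => ⟨MultilinearMap.ofSubsingleton R _ _ 0 ((b f X).flip c), rfl⟩)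
        (fun X c => ⟨MultilinearMap.ofSubsingleton R _ _ 0 ((b f' X).flip c), rfl⟩)
        (fun X Y k c e => bnat f X Y k _ _) (fun X Y k c e => bnat f' X Y k _ _)
        (fun X e => ⟨b f X (e 0), fun _ => rfl⟩) (fun X e => ⟨b f' X (e 0), fun _ => rfl⟩)
        (fun X z e => congrFun (congrFun (congrFun key1 X) (e 0)) z)
    refine (hT.existsUnique_hom N ⟨b f, bnat f⟩).unique (fun X e c => rfl) (fun X e c => ?_)
    exact (congrFun (congrFun (congrFun key2 X) c) (fun _ => e)).symm

end TensorOfExteriorPowers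

end Extension

/-! ### Descent along locally surjective morphisms -/

section Descent

variable {R : Type v} [CommRing R] {D : Type w₁} [Category.{w₂} D] {J : GrothendieckTopology D}
  {F₁ F₂ F₃ N : Dᵒᵖ ⥤ ModuleCat.{u} R} {π : F₂ ⟶ F₃}

theorem eq_of_locally_eq (hN : Presieve.IsSheaf J (N ⋙ forget (ModuleCat.{u} R))) {X : Dᵒᵖ}
    {s t : N.obj X} {K : Sieve X.unop} (hK : K ∈ J X.unop)
    (h : ∀ (Y : D) (f : Y ⟶ X.unop), K f → N.map f.op s = N.map f.op t) : s = t :=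
  (hN K hK).isSeparatedFor.ext fun Y f hf => h Y f hf

theorem exists_sieve_lift {ι : Type*} [Finite ι] (hπ : Presheaf.IsLocallySurjective J π) {X : Dᵒᵖ}
    (z : ι → F₃.obj X) : ∃ K ∈ J X.unop, ∀ (Y : D) (f : Y ⟶ X.unop), K f →
      ∃ y : ι → F₂.obj (op Y), ∀ i, π.app (op Y) (y i) = F₃.map f.op (z i) := by
  have := Fintype.ofFinite ι
  refine ⟨Finset.univ.inf fun i => Presheaf.imageSieve π (z i), ?_, fun Y f hf => ?_⟩
  · exact Finset.inf_induction (J.top_mem _) (fun _ h _ h' => J.intersection_covering h h')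
      (fun i _ => Presheaf.imageSieve_mem J π (z i))
  · have h : ∀ i, Presheaf.imageSieve π (z i) f := fun i =>
      (Finset.inf_le (Finset.mem_univ i) : Finset.univ.inf (fun i => Presheaf.imageSieve π (z i))
        ≤ Presheaf.imageSieve π (z i)) _ hf
    choose y hy using h
    exact ⟨y, hy⟩

/-- A natural family of maps on `F₁^n × F₂^m` with values in a sheaf that is constant on the fibres
of the locally surjective morphism `Id^n × π^m` descends along it. -/
theorem exists_descent (hN : Presieve.IsSheaf J (N ⋙ forget (ModuleCat.{u} R)))
    (hπ : Presheaf.IsLocallySurjective J π) {n m : ℕ}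
    (g : ∀ X, (Fin n → F₁.obj X) → (Fin m → F₂.obj X) → N.obj X)
    (hg : ∀ (X Y : Dᵒᵖ) (f : X ⟶ Y) x y,
      N.map f (g X x y) = g Y (fun i => F₁.map f (x i)) (fun i => F₂.map f (y i)))
    (hinv : ∀ X x y y', (∀ i, π.app X (y i) = π.app X (y' i)) → g X x y = g X x y') :
    ∃ g' : ∀ X, (Fin n → F₁.obj X) → (Fin m → F₃.obj X) → N.obj X,
      (∀ (X Y : Dᵒᵖ) (f : X ⟶ Y) x z,
        N.map f (g' X x z) = g' Y (fun i => F₁.map f (x i)) (fun i => F₃.map f (z i))) ∧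
      ∀ X x y, g' X x (fun i => π.app X (y i)) = g X x y := by
  -- The section s is required to be right for every local lift of z, not only for the chosen ones.
  -- Naturality and the comparison with `g` then follow directly.
  have key : ∀ X (x : Fin n → F₁.obj X) (z : Fin m → F₃.obj X), ∃ s : N.obj X,
      ∀ (Y : D) (f : Y ⟶ X.unop) (y : Fin m → F₂.obj (op Y)),
        (∀ i, π.app (op Y) (y i) = F₃.map f.op (z i)) →
          N.map f.op s = g (op Y) (fun i => F₁.map f.op (x i)) y := by
    intro X x z
    obtain ⟨K, hK, hlift⟩ := exists_sieve_lift hπ z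
    choose l hl using hlift
    let c : Presieve.FamilyOfElements (N ⋙ forget (ModuleCat.{u} R)) K.arrows :=
      fun Y f hf => g (op Y) (fun i => F₁.map f.op (x i)) (l Y f hf)
    have hc : c.Compatible := by
      intro Y₁ Y₂ Z g₁ g₂ f₁ f₂ h₁ h₂ e
      change N.map g₁.op (g _ _ _) = N.map g₂.op (g _ _ _)
      rw [hg, hg]
      simp only [← presheaf_map_comp, ← op_comp, e]
      refine hinv _ _ _ _ fun i => ?_
      rw [NatTrans.naturality_apply, NatTrans.naturality_apply, hl, hl, ← presheaf_map_comp,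
        ← presheaf_map_comp, ← op_comp, ← op_comp, e]
    refine ⟨(hN K hK).amalgamate c hc, fun Y f y hy => ?_⟩
    refine eq_of_locally_eq hN (J.pullback_stable f hK) fun Z k hk => ?_
    have h1 : N.map (k ≫ f).op ((hN K hK).amalgamate c hc) = c (k ≫ f) hk :=
      (hN K hK).valid_glue hc (k ≫ f) hk
    rw [op_comp, presheaf_map_comp] at h1
    refine h1.trans ?_
    rw [hg]
    simp only [c, ← presheaf_map_comp, ← op_comp]
    refine hinv _ _ _ _ fun i => ?_
    refine (hl Z (k ≫ f) hk i).trans ?_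
    rw [NatTrans.naturality_apply, hy, ← presheaf_map_comp, ← op_comp]
  choose g' hg' using key
  have hπ' : ∀ X x y, g' X x (fun i => π.app X (y i)) = g X x y := fun X x y => by
    have := hg' X x (fun i => π.app X (y i)) X.unop (𝟙 _) y (fun i => by simp)
    simpa using this
  refine ⟨g', fun X Y f x z => ?_, hπ'⟩
  obtain ⟨K, hK, hlift⟩ := exists_sieve_lift (X := Y) hπ (fun i => F₃.map f (z i))
  refine eq_of_locally_eq hN hK fun Z k hk => ?_
  obtain ⟨y, hy⟩ := hlift Z k hk
  rw [hg' Y _ _ Z k y hy, ← presheaf_map_comp]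
  refine (hg' X x z Z (k ≫ f.unop) y fun i => ?_).trans ?_
  · rw [hy, ← presheaf_map_comp]
    rfl
  · simp only [← presheaf_map_comp]
    rfl

section Transfer

variable (hN : Presieve.IsSheaf J (N ⋙ forget (ModuleCat.{u} R)))
    (hπ : Presheaf.IsLocallySurjective J π) {n m : ℕ}
    (g : ∀ X, (Fin n → F₁.obj X) → (Fin m → F₂.obj X) → N.obj X)
    (g' : ∀ X, (Fin n → F₁.obj X) → (Fin m → F₃.obj X) → N.obj X)
    (hg' : ∀ (X Y : Dᵒᵖ) (f : X ⟶ Y) x z,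
        N.map f (g' X x z) = g' Y (fun i => F₁.map f (x i)) (fun i => F₃.map f (z i)))
    (h : ∀ X x y, g' X x (fun i => π.app X (y i)) = g X x y)

include hN hπ hg' h

/-- The covering sieve depends only on z, so all the vectors x are handled over one cover, where
`g'` agrees with `g` at a fixed lift of z. -/
theorem descent_alternating_left
    (hg : ∀ X y, ∃ φ : (F₁.obj X) [⋀^Fin n]→ₗ[R] N.obj X, ∀ x, φ x = g X x y) (X : Dᵒᵖ)
    (z : Fin m → F₃.obj X) : ∃ φ : (F₁.obj X) [⋀^Fin n]→ₗ[R] N.obj X, ∀ x, φ x = g' X x z := by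
  obtain ⟨K, hK, hlift⟩ := exists_sieve_lift hπ z
  have key : ∀ (Y : D) (f : Y ⟶ X.unop), K f →
      ∃ φ : (F₁.obj (op Y)) [⋀^Fin n]→ₗ[R] N.obj (op Y),
        ∀ x, N.map f.op (g' X x z) = φ fun i => F₁.map f.op (x i) := fun Y f hf => by
    obtain ⟨y, hy⟩ := hlift Y f hf
    obtain ⟨φ, hφ⟩ := hg (op Y) y
    refine ⟨φ, fun x => ?_⟩
    rw [hφ, hg', ← h]
    simp only [hy]
  refine ⟨
    { toFun := fun x => g' X x z
      map_update_add' := ?_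
      map_update_smul' := ?_
      map_eq_zero_of_eq' := ?_ }, fun x => rfl⟩
  · intro inst x i a b
    cases Subsingleton.elim inst (instDecidableEqFin n)
    refine eq_of_locally_eq hN hK fun Y f hf => ?_
    obtain ⟨φ, hφ⟩ := key Y f hf
    simp only [map_add, hφ, comp_update, φ.map_update_add]
  · intro inst x i a b
    cases Subsingleton.elim inst (instDecidableEqFin n)
    refine eq_of_locally_eq hN hK fun Y f hf => ?_
    obtain ⟨φ, hφ⟩ := key Y f hf
    simp only [map_smul, hφ, comp_update, φ.map_update_smul]
  · intro x i j hx hij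
    refine eq_of_locally_eq hN hK fun Y f hf => ?_
    obtain ⟨φ, hφ⟩ := key Y f hf
    rw [hφ, map_zero]
    exact φ.map_eq_zero_of_eq _ (by rw [hx]) hij

/-- Here the descended variable itself varies, so each identity needs a cover on which the new
entries lift together with z. -/
theorem descent_alternating_right
    (hg : ∀ X x, ∃ φ : (F₂.obj X) [⋀^Fin m]→ₗ[R] N.obj X, ∀ y, φ y = g X x y) (X : Dᵒᵖ)
    (x : Fin n → F₁.obj X) : ∃ φ : (F₃.obj X) [⋀^Fin m]→ₗ[R] N.obj X, ∀ z, φ z = g' X x z := by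
  have key : ∀ (Y : D) (f : Y ⟶ X.unop) (z : Fin m → F₃.obj X) (y : Fin m → F₂.obj (op Y)),
      (∀ i, π.app (op Y) (y i) = F₃.map f.op (z i)) →
      N.map f.op (g' X x z) = g (op Y) (fun i => F₁.map f.op (x i)) y := fun Y f z y hy => by
    rw [← h, hg']
    simp only [hy]
  have upd : ∀ {Y : D} {f : Y ⟶ X.unop} {z : Fin m → F₃.obj X} {y : Fin m → F₂.obj (op Y)}
      {a : F₃.obj X} {b : F₂.obj (op Y)} (i : Fin m),
      (∀ i, π.app (op Y) (y i) = F₃.map f.op (z i)) → π.app (op Y) b = F₃.map f.op a →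
      ∀ k, π.app (op Y) (Function.update y i b k) = F₃.map f.op (Function.update z i a k) := by
    intro Y f z y a b i hy hb k
    by_cases hk : k = i
    · subst hk
      simpa using hb
    · simpa [hk] using hy k
  refine ⟨
    { toFun := fun z => g' X x z
      map_update_add' := ?_
      map_update_smul' := ?_
      map_eq_zero_of_eq' := ?_ }, fun x => rfl⟩
  · intro inst z i a b
    cases Subsingleton.elim inst (instDecidableEqFin m)
    obtain ⟨K, hK, hlift⟩ := exists_sieve_lift hπ (Sum.elim z ![a, b])
    refine eq_of_locally_eq hN hK fun Y f hf => ?_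
    obtain ⟨y, hy⟩ := hlift Y f hf
    have hz : ∀ i, π.app (op Y) (y (Sum.inl i)) = F₃.map f.op (z i) := fun i => hy (Sum.inl i)
    have ha := hy (Sum.inr 0)
    have hb := hy (Sum.inr 1)
    simp only [Sum.elim_inr, Matrix.cons_val_zero, Matrix.cons_val_one] at ha hb
    obtain ⟨φ, hφ⟩ := hg (op Y) (fun i => F₁.map f.op (x i))
    rw [map_add, key Y f _ _ (upd i hz ha), key Y f _ _ (upd i hz hb),
      key Y f _ _ (upd i hz (b := y (Sum.inr 0) + y (Sum.inr 1)) (by rw [map_add, map_add, ha, hb])),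
      ← hφ, ← hφ, ← hφ, φ.map_update_add]
  · intro inst z i c a
    cases Subsingleton.elim inst (instDecidableEqFin m)
    obtain ⟨K, hK, hlift⟩ := exists_sieve_lift hπ (Sum.elim z ![a])
    refine eq_of_locally_eq hN hK fun Y f hf => ?_
    obtain ⟨y, hy⟩ := hlift Y f hf
    have hz : ∀ i, π.app (op Y) (y (Sum.inl i)) = F₃.map f.op (z i) := fun i => hy (Sum.inl i)
    have ha := hy (Sum.inr 0)
    simp only [Sum.elim_inr, Matrix.cons_val_zero] at ha
    obtain ⟨φ, hφ⟩ := hg (op Y) (fun i => F₁.map f.op (x i))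
    rw [map_smul, key Y f _ _ (upd i hz ha),
      key Y f _ _ (upd i hz (b := c • y (Sum.inr 0)) (by rw [map_smul, map_smul, ha])),
      ← hφ, ← hφ, φ.map_update_smul]
  · intro z i j hz hij
    obtain ⟨K, hK, hlift⟩ := exists_sieve_lift hπ z
    refine eq_of_locally_eq hN hK fun Y f hf => ?_
    obtain ⟨y, hy⟩ := hlift Y f hf
    obtain ⟨φ, hφ⟩ := hg (op Y) (fun i => F₁.map f.op (x i))
    -- Lifts of the equal entries z i and z j may differ; replacing y j by y i gives a lift with a
    -- genuine repetition.
    have hy' : ∀ k, π.app (op Y) (Function.update y j (y i) k) = F₃.map f.op (z k) := by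
      have := upd j hy (a := z j) (b := y i) (by rw [hy, hz])
      simpa using this
    rw [map_zero, key Y f z _ hy', ← hφ]
    exact φ.map_eq_zero_of_eq _ (by simp [hij]) hij

end Transfer

/-- An alternating map that vanishes when some argument is in the kernel of `π` only depends on the
images of its arguments. -/
theorem _root_.AlternatingMap.eq_of_map_eq {A B C : Type*} [AddCommGroup A] [Module R A]
    [AddCommGroup B] [Module R B] [AddCommGroup C] [Module R C] {m : ℕ} (φ : A [⋀^Fin m]→ₗ[R] C)
    (p : A →ₗ[R] B) (h : ∀ y i, p (y i) = 0 → φ y = 0) (y y' : Fin m → A)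
    (hy : ∀ i, p (y i) = p (y' i)) : φ y = φ y' := by
  classical
  have key : ∀ s : Finset (Fin m), φ (s.piecewise y y') = φ y' := by
    intro s
    induction s using Finset.induction_on with
    | empty => simp
    | insert i s hi ih =>
      rw [← ih, Finset.piecewise_insert, ← sub_eq_zero]
      -- Adding i to s replaces the entry y' i by y i, so the two values of φ differ by its value
      -- with y i - y' i in position i, which lies in ker p.
      have e : s.piecewise y y' = Function.update (s.piecewise y y') i (y' i) := by
        rw [eq_comm, Function.update_eq_self_iff, Finset.piecewise_eq_of_notMem _ _ _ hi]
      conv_lhs => enter [2]; rw [e]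
      rw [← φ.map_update_sub]
      exact h _ i (by simp [hy])
  simpa using key Finset.univ

/-- An alternating morphism to a sheaf that vanishes when some argument is in the kernel of a
locally surjective morphism descends along it. -/
theorem exists_alt_descent (hN : Presieve.IsSheaf J (N ⋙ forget (ModuleCat.{u} R)))
    (hπ : Presheaf.IsLocallySurjective J π) {m : ℕ} (G : Alt F₂ N m)
    (hG : ∀ X y i, π.app X (y i) = 0 → G.1 X y = 0) :
    ∃ G' : Alt F₃ N m, ∀ X y, G'.1 X (fun i => π.app X (y i)) = G.1 X y := by
  -- With n = 0 the first factor is a dummy, so any presheaf can serve as `F₁`.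
  obtain ⟨g', hg', h⟩ := exists_descent (F₁ := F₂) (n := 0) hN hπ (fun X _ y => G.1 X y)
    (fun X Y f _ y => G.2 X Y f y)
    (fun X _ y y' hy => (G.1 X).eq_of_map_eq (π.app X).hom (hG X) y y' hy)
  choose φ hφ using descent_alternating_right hN hπ _ g' hg' h (fun X _ => ⟨G.1 X, fun _ => rfl⟩)
  refine ⟨⟨fun X => φ X 0, fun X Y f z => ?_⟩, fun X y => ?_⟩
  · rw [hφ, hφ, hg']
    congr 1
    exact Subsingleton.elim _ _
  · change φ X 0 _ = _
    rw [hφ, h]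

/-- A bialternating map given by a function. -/
theorem exists_alternatingMap_alternatingMap {A B C : Type*} [AddCommGroup A] [Module R A]
    [AddCommGroup B] [Module R B] [AddCommGroup C] [Module R C] {n m : ℕ}
    (g : (Fin n → A) → (Fin m → B) → C)
    (hl : ∀ y, ∃ φ : A [⋀^Fin n]→ₗ[R] C, ∀ x, φ x = g x y)
    (hr : ∀ x, ∃ φ : B [⋀^Fin m]→ₗ[R] C, ∀ y, φ y = g x y) :
    ∃ Φ : A [⋀^Fin n]→ₗ[R] (B [⋀^Fin m]→ₗ[R] C), ∀ x y, Φ x y = g x y := by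
  choose l hl using hl
  choose r hr using hr
  refine ⟨
    { toFun := r
      map_update_add' := ?_
      map_update_smul' := ?_
      map_eq_zero_of_eq' := ?_ }, hr⟩
  · intro inst x i a b
    cases Subsingleton.elim inst (instDecidableEqFin n)
    ext y
    simp [hr, ← hl]
  · intro inst x i a b
    cases Subsingleton.elim inst (instDecidableEqFin n)
    ext y
    simp [hr, ← hl]
  · intro x i j h hij
    ext y
    rw [hr, ← hl]
    exact (l y).map_eq_zero_of_eq _ h hij

theorem exists_biAlt_descent (hN : Presieve.IsSheaf J (N ⋙ forget (ModuleCat.{u} R)))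
    (hπ : Presheaf.IsLocallySurjective J π) {n m : ℕ} (G : BiAlt F₁ F₂ N n m)
    (hG : ∀ X x y i, π.app X (y i) = 0 → G.1 X x y = 0) :
    ∃ G' : BiAlt F₁ F₃ N n m, pullbackBiAlt F₁ π N n m G' = G := by
  obtain ⟨g', hg', h⟩ := exists_descent hN hπ (fun X x y => G.1 X x y)
    (fun X Y f x y => G.2 X Y f x y)
    (fun X x y y' hy => (G.1 X x).eq_of_map_eq (π.app X).hom (hG X x) y y' hy)
  have hl := descent_alternating_left hN hπ _ g' hg' h
    (fun X y => ⟨LinearMap.compAlternatingMap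
        { toFun := fun ψ => ψ y
          map_add' := fun _ _ => rfl
          map_smul' := fun _ _ => rfl } (G.1 X), fun x => rfl⟩)
  have hr := descent_alternating_right hN hπ _ g' hg' h (fun X x => ⟨G.1 X x, fun _ => rfl⟩)
  choose Φ hΦ using fun X => exists_alternatingMap_alternatingMap (g' X) (hl X) (hr X)
  refine ⟨⟨Φ, fun X Y f x z => by rw [hΦ, hΦ, hg']⟩, Subtype.ext (funext fun X => ?_)⟩
  ext x y
  change Φ X x (fun j => π.app X (y j)) = _
  rw [hΦ, h]

theorem pullbackBiAlt_injective (hN : Presieve.IsSheaf J (N ⋙ forget (ModuleCat.{u} R)))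
    (hπ : Presheaf.IsLocallySurjective J π) (n m : ℕ) :
    Function.Injective (pullbackBiAlt F₁ π N n m) := by
  intro β β' h
  refine Subtype.ext (funext fun X => ?_)
  ext x z
  obtain ⟨K, hK, hlift⟩ := exists_sieve_lift hπ z
  refine eq_of_locally_eq hN hK fun Y f hf => ?_
  obtain ⟨y, hy⟩ := hlift Y f hf
  have := congrArg (fun b => b.1 (op Y) (fun i => F₁.map f.op (x i)) y) h
  change β.1 (op Y) _ (fun j => π.app (op Y) (y j)) = β'.1 (op Y) _ (fun j => π.app (op Y) (y j))
    at this
  rw [β.2, β'.2]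
  simpa only [hy] using this

end Descent

/-- The fppf topology is subcanonical. This applies to the target N and also to the inner module
schemes Q, to which descent is applied in (a). -/
theorem ModuleScheme.isSheaf {R : Type v} [CommRing R] {S : Scheme.{u}}
    (N : ModuleScheme.{u} R S) :
    Presieve.IsSheaf (Scheme.fppfTopology.{u}.over S) (N.obj ⋙ forget (ModuleCat.{u} R)) :=
  have := N.property
  have : (N.obj ⋙ forget (ModuleCat.{u} R)).IsRepresentable := this
  GrothendieckTopology.Subcanonical.isSheaf_of_isRepresentable _

/-! ### Fixing some arguments of an alternating map -/

section SumElim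

variable {R : Type*} [CommRing R] {A B C : Type*} [AddCommGroup A] [Module R A]
  [AddCommGroup B] [Module R B] [AddCommGroup C] [Module R C] {n k r : ℕ}

theorem exists_alternatingMap_sumElim (φ : B [⋀^Fin n]→ₗ[R] C) (σ : Fin k ⊕ Fin r ≃ Fin n)
    (f : A →ₗ[R] B) (w : Fin r → B) :
    ∃ ψ : A [⋀^Fin k]→ₗ[R] C,
      ∀ y, ψ y = φ (fun i => Sum.elim (fun j => f (y j)) w (σ.symm i)) := by
  let Φ := φ.domDomCongr σ.symm
  refine ⟨
    { toFun := fun y => Φ (Sum.elim (fun j => f (y j)) w)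
      map_update_add' := ?_
      map_update_smul' := ?_
      map_eq_zero_of_eq' := ?_ }, fun y => rfl⟩
  · intro inst y i a b
    cases Subsingleton.elim inst (instDecidableEqFin k)
    simp only [Function.apply_update (fun _ => f), Sum.elim_update_left, map_add, Φ.map_update_add]
  · intro inst y i c a
    cases Subsingleton.elim inst (instDecidableEqFin k)
    simp only [Function.apply_update (fun _ => f), Sum.elim_update_left, map_smul,
      Φ.map_update_smul]
  · intro y i j h hij
    exact Φ.map_eq_zero_of_eq _ (i := Sum.inl i) (j := Sum.inl j) (by simp [h]) (by simpa using hij)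

theorem exists_multilinearMap_sumElim (φ : B [⋀^Fin n]→ₗ[R] C) (σ : Fin k ⊕ Fin r ≃ Fin n)
    {P : Fin r → Type*} [∀ i, AddCommGroup (P i)] [∀ i, Module R (P i)] (κ : ∀ i, P i →ₗ[R] B)
    (y : Fin k → B) :
    ∃ ψ : MultilinearMap R P C,
      ∀ w, ψ w = φ (fun i => Sum.elim y (fun j => κ j (w j)) (σ.symm i)) := by
  let Φ := φ.domDomCongr σ.symm
  refine ⟨
    { toFun := fun w => Φ (Sum.elim y (fun j => κ j (w j)))
      map_update_add' := ?_
      map_update_smul' := ?_ }, fun y => rfl⟩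
  · intro inst w i a b
    cases Subsingleton.elim inst (instDecidableEqFin r)
    simp only [Function.apply_update (fun i => κ i), Sum.elim_update_right, map_add,
      Φ.map_update_add]
  · intro inst w i c a
    cases Subsingleton.elim inst (instDecidableEqFin r)
    simp only [Function.apply_update (fun i => κ i), Sum.elim_update_right, map_smul,
      Φ.map_update_smul]

end SumElim

/-! ### Vanishing of alternating morphisms; parts (a) and (b) -/

section Vanishing

variable {R : Type v} [CommRing R] {S : Scheme.{u}} {F M₁ M₂ M₃ N : ModuleScheme.{u} R S}

/-- Fixing the arguments outside a set of `k` positions turns an alternating morphism into an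
alternating morphism in `k` arguments with values in an inner multilinear functor. -/
theorem exists_alt_innerMult {n k r : ℕ} (φ : Alt M₂.obj N.obj n) (σ : Fin k ⊕ Fin r ≃ Fin n)
    (f : F ⟶ M₂) {P : Fin r → ModuleScheme.{u} R S} (κ : ∀ i, P i ⟶ M₂)
    (hP : InnerMultExists P N) :
    ∃ (Q : ModuleScheme.{u} R S) (rep : InnerRep Q.obj N.obj (fun X => ∀ i, (P i).obj.obj X)
      (fun f x i => (P i).obj.map f (x i))
      (fun X => multilinearMaps (R := R) (fun i => (P i).obj.obj X) (N.obj.obj X)))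
      (G : Alt F.obj Q.obj k), ∀ X y w, rep.ev X (G.1 X y) w =
        φ.1 X (fun i => Sum.elim (fun j => f.hom.app X (y j))
          (fun j => (κ j).hom.app X (w j)) (σ.symm i)) := by
  obtain ⟨Q, ⟨rep⟩⟩ := hP.exists_rep
  obtain ⟨G, hG⟩ := rep.exists_alt (M := F.obj) (n := k) (fun X y w =>
        φ.1 X (fun i => Sum.elim (fun j => f.hom.app X (y j))
          (fun j => (κ j).hom.app X (w j)) (σ.symm i)))
    (fun X y => by
      obtain ⟨ψ, hψ⟩ := exists_multilinearMap_sumElim (φ.1 X) σ (fun i => ((κ i).hom.app X).hom)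
        (fun j => f.hom.app X (y j))
      exact ⟨ψ, funext hψ⟩)
    (fun X Y g y w => by
      rw [φ.2]
      congr 1
      funext i
      rcases σ.symm i with j | j
      · exact (NatTrans.naturality_apply f.hom g _).symm
      · exact (NatTrans.naturality_apply (κ j).hom g _).symm)
    (fun X w => exists_alternatingMap_sumElim (φ.1 X) σ (f.hom.app X).hom _)
  exact ⟨Q, rep, G, fun X y w => congrFun (hG X y) w⟩

theorem exists_subset_equiv {n k : ℕ} (A : Finset (Fin n)) (hA : k ≤ A.card) :
    ∃ σ : Fin k ⊕ Fin (n - k) ≃ Fin n, ∀ j, σ (Sum.inl j) ∈ A := by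
  obtain ⟨B, hBA, hB⟩ := Finset.exists_subset_card_eq hA
  have hBc : Bᶜ.card = n - k := by rw [Finset.card_compl, Fintype.card_fin, hB]
  exact ⟨finSumEquivOfFinset hB hBc, fun j => hBA (by simp)⟩

/-- If the `k`-th exterior power of `F` vanishes, then an alternating morphism vanishes as soon as
`k` of its arguments come from `F`. -/
theorem alt_eq_zero_of_exteriorPowerIsZero {n k : ℕ} (hF : ExteriorPowerIsZero F k) (f : F ⟶ M₂)
    (φ : Alt M₂.obj N.obj n)
    (hN : InnerMultExists (fun _ : Fin (n - k) => M₂) N) {X : (Over S)ᵒᵖ}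
    (v : Fin n → M₂.obj.obj X) (A : Finset (Fin n)) (hA : k ≤ A.card)
    (hv : ∀ i ∈ A, ∃ z, f.hom.app X z = v i) : φ.1 X v = 0 := by
  obtain ⟨σ, hσ⟩ := exists_subset_equiv A hA
  obtain ⟨Q, rep, G, hG⟩ := exists_alt_innerMult φ σ f (fun _ => 𝟙 M₂) hN
  choose z hz using fun j => hv _ (hσ j)
  have := hG X z (fun j => v (σ (Sum.inr j)))
  rw [hF.alt_eq_zero G] at this
  have h0 : rep.ev X ((0 : Alt F.obj Q.obj k).1 X z) = 0 := map_zero _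
  rw [h0] at this
  refine Eq.trans ?_ this.symm
  congr 1
  funext i
  obtain ⟨i, rfl⟩ := σ.surjective i
  rcases i with j | j
  · simp [hz]
  · simp

/-- If the `k`-th exterior power of `M₃` vanishes and an alternating morphism on `M₂` vanishes as
soon as `a + 1` arguments are in the kernel of `π : M₂ → M₃`, then it already vanishes if
`a` arguments are in the kernel, provided that there are `k` further arguments. -/
theorem alt_eq_zero_of_card_succ {ι : M₁ ⟶ M₂} {π : M₂ ⟶ M₃} (hex : IsShortExact ι π) {n k a : ℕ}
    (hM : ExteriorPowerIsZero M₃ k) (φ : Alt M₂.obj N.obj n) (hak : a + k ≤ n)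
    (hN : ∀ P : Fin (n - k) → ModuleScheme.{u} R S, (∀ i, P i = M₁ ∨ P i = M₂ ∨ P i = M₃) →
      InnerMultExists P N)
    (hZ : ∀ X v (A : Finset (Fin n)), a + 1 ≤ A.card → (∀ i ∈ A, π.hom.app X (v i) = 0) →
      φ.1 X v = 0)
    {X : (Over S)ᵒᵖ} (v : Fin n → M₂.obj.obj X) (A : Finset (Fin n)) (hA : A.card = a)
    (hv : ∀ i ∈ A, π.hom.app X (v i) = 0) : φ.1 X v = 0 := by
  classical
  obtain ⟨σ, hσ⟩ := exists_subset_equiv (k := k) Aᶜ (by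
    rw [Finset.card_compl, Fintype.card_fin, hA]; omega)
  -- The positions in A are restricted to M₁, so that they stay in ker π for every value of the
  -- parameters w and not merely for the given v. This is why inner Mult with mixed factors is
  -- needed.
  let q : Fin (n - k) → Σ P : ModuleScheme.{u} R S, P ⟶ M₂ := fun j =>
    if σ (Sum.inr j) ∈ A then ⟨M₁, ι⟩ else ⟨M₂, 𝟙 M₂⟩
  have hq : ∀ j, (q j).1 = M₁ ∨ (q j).1 = M₂ ∨ (q j).1 = M₃ := fun j => by
    by_cases h : σ (Sum.inr j) ∈ A
    · simp [q, h]
    · simp [q, h]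
  have hqker : ∀ j, σ (Sum.inr j) ∈ A → ∀ X w, π.hom.app X ((q j).2.hom.app X w) = 0 := fun j h => by
    have e : q j = ⟨M₁, ι⟩ := if_pos h
    rw [e]
    exact fun X w => (hex.exact X).apply_apply_eq_zero w
  have hqsurj : ∀ j, ∃ w, (q j).2.hom.app X w = v (σ (Sum.inr j)) := fun j => by
    by_cases h : σ (Sum.inr j) ∈ A
    · have e : q j = ⟨M₁, ι⟩ := if_pos h
      rw [e]
      exact (hex.exact X _).1 (hv _ h)
    · have e : q j = ⟨M₂, 𝟙 M₂⟩ := if_neg h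
      rw [e]
      exact ⟨v (σ (Sum.inr j)), rfl⟩
  obtain ⟨Q, rep, G, hG⟩ := exists_alt_innerMult φ σ (𝟙 M₂) (fun j => (q j).2) (hN _ hq)
  have hvan : ∀ Y y i, π.hom.app Y (y i) = 0 → G.1 Y y = 0 := by
    -- A kernel entry at a position outside A, together with the `a` positions of A, makes a + 1
    -- kernel arguments, so `hZ` applies.
    intro Y y i hy
    refine rep.ext _ _ _ fun Z f => ?_
    rw [map_zero, map_zero, G.2]
    funext w
    rw [hG]
    refine hZ Z _ (insert (σ (Sum.inl i)) A) ?_ fun l hl => ?_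
    · rw [Finset.card_insert_of_notMem (Finset.mem_compl.1 (hσ i)), hA]
    · rcases Finset.mem_insert.1 hl with rfl | hl
      · simp only [Equiv.symm_apply_apply, Sum.elim_inl]
        change π.hom.app Z (M₂.obj.map f (y i)) = 0
        rw [NatTrans.naturality_apply, hy, map_zero]
      · obtain ⟨l, rfl⟩ := σ.surjective l
        rcases l with j | j
        · exact absurd hl (Finset.mem_compl.1 (hσ j))
        · simp only [Equiv.symm_apply_apply, Sum.elim_inr]
          exact hqker j hl Z _
  obtain ⟨G', hG'⟩ := exists_alt_descent Q.isSheaf hex.locally_surjective G hvan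
  choose w hw using hqsurj
  have := hG X (fun j => v (σ (Sum.inl j))) w
  rw [← hG', hM.alt_eq_zero G'] at this
  have h0 : rep.ev X ((0 : Alt M₃.obj Q.obj k).1 X
    (fun i => π.hom.app X (v (σ (Sum.inl i))))) = 0 := map_zero _
  rw [h0] at this
  refine Eq.trans ?_ this.symm
  congr 1
  funext i
  obtain ⟨i, rfl⟩ := σ.surjective i
  rcases i with j | j
  · simp
  · simp [hw]

theorem restrictAlt_injective {ι : M₁ ⟶ M₂} {π : M₂ ⟶ M₃} (hex : IsShortExact ι π) {n₁ n₃ : ℕ}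
    (hM : ExteriorPowerIsZero M₃ (n₃ + 1)) (hN : InnerMultsExist M₁ M₂ M₃ (n₁ + n₃) N) :
    Function.Injective (restrictAlt ι.hom N.obj n₁ n₃) := by
  refine (injective_iff_map_eq_zero _).2 fun φ hφ => ?_
  -- A permutation moves n₁ kernel arguments to the front at the cost of a sign; the value is then
  -- one of the restriction of φ, which is zero.
  have base : ∀ X v (A : Finset (Fin (n₁ + n₃))), n₁ ≤ A.card →
      (∀ i ∈ A, π.hom.app X (v i) = 0) → φ.1 X v = 0 := by
    intro X v A hA hv
    obtain ⟨B, hBA, hB⟩ := Finset.exists_subset_card_eq hA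
    have hBc : Bᶜ.card = n₃ := by rw [Finset.card_compl, Fintype.card_fin, hB]; omega
    let σ := finSumEquivOfFinset hB hBc
    have hσ : ∀ j, σ (Sum.inl j) ∈ A := fun j => hBA (by simp [σ])
    choose x hx using fun j => (hex.exact X _).1 (hv _ (hσ j))
    have h := (φ.1 X).map_perm v (finSumFinEquiv.symm.trans σ)
    have e : v ∘ (finSumFinEquiv.symm.trans σ)
        = Fin.append (fun i => ι.hom.app X (x i)) (fun j => v (σ (Sum.inr j))) := by
      funext i
      refine Fin.addCases (fun k => ?_) (fun k => ?_) i
      · simp [hx]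
      · simp
    have h1 := congrArg (fun b => b.1 X x (fun j => v (σ (Sum.inr j)))) hφ
    change φ.1 X (Fin.append (fun i => ι.hom.app X (x i)) _) = 0 at h1
    rw [e, h1] at h
    rcases Int.units_eq_one_or (Equiv.Perm.sign (finSumFinEquiv.symm.trans σ)) with hs | hs
    · rw [hs, one_smul] at h
      exact h.symm
    · rw [hs, Units.neg_smul, one_smul] at h
      exact neg_eq_zero.1 h.symm
  -- Downward induction on the number a = n₁ - d of kernel arguments; a = 0 imposes no condition on
  -- v.
  have step : ∀ d a, a + d = n₁ → ∀ X v (A : Finset (Fin (n₁ + n₃))), a ≤ A.card →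
      (∀ i ∈ A, π.hom.app X (v i) = 0) → φ.1 X v = 0 := by
    intro d
    induction d with
    | zero => intro a ha; rw [add_zero] at ha; subst ha; exact base
    | succ d ih =>
      intro a ha X v A hA hv
      rcases hA.eq_or_lt with h | h
      · exact alt_eq_zero_of_card_succ hex hM φ (by omega) (fun P hP => hN _ (by omega) P hP)
          (ih (a + 1) (by omega)) v A h.symm hv
      · exact ih (a + 1) (by omega) X v A h hv
  refine Subtype.ext (funext fun X => AlternatingMap.ext fun v => ?_)
  exact step n₁ 0 (by omega) X v ∅ (by simp) (by simp)

/-- If some y i is in ker π, it comes from M₁ by exactness. Together with the n₁ entries of x this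
makes n₁ + 1 arguments from M₁, so φ vanishes and its restriction descends. -/
theorem exists_pullbackBiAlt_eq_restrictAlt {ι : M₁ ⟶ M₂} {π : M₂ ⟶ M₃} (hex : IsShortExact ι π)
    {n₁ n₃ : ℕ} (hM : ExteriorPowerIsZero M₁ (n₁ + 1))
    (hN : InnerMultsExist M₁ M₂ M₃ (n₁ + n₃) N) (φ : Alt M₂.obj N.obj (n₁ + n₃)) :
    ∃ β : BiAlt M₁.obj M₃.obj N.obj n₁ n₃,
      pullbackBiAlt M₁.obj π.hom N.obj n₁ n₃ β = restrictAlt ι.hom N.obj n₁ n₃ φ := by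
  refine exists_biAlt_descent N.isSheaf hex.locally_surjective _ fun X x y i hy => ?_
  change φ.1 X (Fin.append (fun i => ι.hom.app X (x i)) y) = 0
  -- The index i forces n₃ > 0, so the number n₁ + n₃ - (n₁ + 1) of fixed arguments is below n₁ +
  -- n₃, as admissibility requires.
  have := i.pos
  have hle : n₁ + 1 ≤ (insert (Fin.natAdd n₁ i)
      ((Finset.univ : Finset (Fin n₁)).map (Fin.castAddEmb n₃))).card := by
    rw [Finset.card_insert_of_notMem, Finset.card_map, Finset.card_univ, Fintype.card_fin]
    simp only [Finset.mem_map, Finset.mem_univ, true_and, not_exists]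
    intro j hj
    have := congrArg Fin.val hj
    have := j.isLt
    simp at *
    omega
  refine alt_eq_zero_of_exteriorPowerIsZero hM ι φ
    (hN _ (by omega) _ fun _ => Or.inr (Or.inl rfl)) _ _ hle fun l hl => ?_
  rcases Finset.mem_insert.1 hl with rfl | hl
  · rw [Fin.append_right]
    exact (hex.exact X _).1 hy
  · obtain ⟨j, -, rfl⟩ := Finset.mem_map.1 hl
    exact ⟨x j, by simp⟩

theorem exists_restrictAlt_eq_pullbackBiAlt_comp {ι : M₁ ⟶ M₂} {π : M₂ ⟶ M₃}
    (hex : IsShortExact ι π) {n₁ n₃ : ℕ} (hM : ExteriorPowerIsZero M₁ (n₁ + 1))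
    (hN : InnerMultsExist M₁ M₂ M₃ (n₁ + n₃) N) :
    ∃ μ : Alt M₂.obj N.obj (n₁ + n₃) →ₗ[R] BiAlt M₁.obj M₃.obj N.obj n₁ n₃,
      restrictAlt ι.hom N.obj n₁ n₃ = pullbackBiAlt M₁.obj π.hom N.obj n₁ n₃ ∘ₗ μ := by
  have hinj := pullbackBiAlt_injective (F₁ := M₁.obj) N.isSheaf hex.locally_surjective n₁ n₃
  choose μ hμ using exists_pullbackBiAlt_eq_restrictAlt hex hM hN
  refine ⟨
    { toFun := μ
      map_add' := fun a b => hinj (by rw [map_add, hμ, hμ, hμ, map_add])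
      map_smul' := fun c a => hinj (by rw [RingHom.id_apply, map_smul, hμ, hμ, map_smul]) }, ?_⟩
  exact LinearMap.ext fun φ => (hμ φ).symm

end Vanishing

/-! ### Wedge products of alternating maps -/

section Wedge

open AlternatingMap in
theorem lift_summand_mk {R A B C E : Type*} [CommRing R] [AddCommGroup A] [Module R A]
    [AddCommGroup B] [Module R B] [AddCommGroup C] [Module R C] [AddCommGroup E] [Module R E]
    {n m : ℕ} (α : A [⋀^Fin n]→ₗ[R] B) (β : A [⋀^Fin m]→ₗ[R] C) (τ : B →ₗ[R] C →ₗ[R] E)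
    (σ : Equiv.Perm (Fin n ⊕ Fin m)) (w : Fin n ⊕ Fin m → A) :
    TensorProduct.lift τ (domCoprod.summand α β (Quotient.mk'' σ) w)
      = Equiv.Perm.sign σ •
        τ (α fun i => w (σ (Sum.inl i))) (β fun j => w (σ (Sum.inr j))) := by
  rw [domCoprod.summand_mk'']
  rcases Int.units_eq_one_or (Equiv.Perm.sign σ) with hs | hs
  · simp [hs]
  · simp [hs]

/-- The wedge product of two alternating maps, with values multiplied by a bilinear map. -/
def wedge {R A B C E : Type*} [CommRing R] [AddCommGroup A] [Module R A]
    [AddCommGroup B] [Module R B] [AddCommGroup C] [Module R C] [AddCommGroup E] [Module R E]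
    {n m : ℕ} (α : A [⋀^Fin n]→ₗ[R] B) (β : A [⋀^Fin m]→ₗ[R] C) (τ : B →ₗ[R] C →ₗ[R] E) :
    A [⋀^Fin (n + m)]→ₗ[R] E :=
  (TensorProduct.lift τ).compAlternatingMap ((α.domCoprod β).domDomCongr finSumFinEquiv)

section

variable {R A B C E A' B' C' E' : Type*} [CommRing R] [AddCommGroup A] [Module R A]
    [AddCommGroup B] [Module R B] [AddCommGroup C] [Module R C] [AddCommGroup E] [Module R E]
    [AddCommGroup A'] [Module R A'] [AddCommGroup B'] [Module R B'] [AddCommGroup C'] [Module R C']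
    [AddCommGroup E'] [Module R E']
    {n m : ℕ} (α : A [⋀^Fin n]→ₗ[R] B) (β : A [⋀^Fin m]→ₗ[R] C) (τ : B →ₗ[R] C →ₗ[R] E)

theorem wedge_apply (v : Fin (n + m) → A) :
    wedge α β τ v = ∑ σ : Equiv.Perm.ModSumCongr (Fin n) (Fin m),
      TensorProduct.lift τ
        (AlternatingMap.domCoprod.summand α β σ (fun i => v (finSumFinEquiv i))) := by
  change TensorProduct.lift τ ((∑ σ : Equiv.Perm.ModSumCongr (Fin n) (Fin m),
    AlternatingMap.domCoprod.summand α β σ) fun i => v (finSumFinEquiv i)) = _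
  rw [sum_apply, map_sum]

theorem map_wedge (α' : A' [⋀^Fin n]→ₗ[R] B') (β' : A' [⋀^Fin m]→ₗ[R] C')
    (τ' : B' →ₗ[R] C' →ₗ[R] E') (f : A → A') (e : E →ₗ[R] E')
    (h : ∀ x y, e (τ (α x) (β y)) = τ' (α' fun i => f (x i)) (β' fun j => f (y j)))
    (v : Fin (n + m) → A) : e (wedge α β τ v) = wedge α' β' τ' (fun i => f (v i)) := by
  rw [wedge_apply, wedge_apply, map_sum]
  refine Finset.sum_congr rfl fun σ _ => ?_
  induction σ using Quotient.inductionOn' with | _ σ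
  rw [lift_summand_mk, lift_summand_mk]
  rcases Int.units_eq_one_or (Equiv.Perm.sign σ) with hs | hs
  · simp [hs, h]
  · simp [hs, h]

/-- If `β` vanishes as soon as some argument is one of the `x i`, then only the trivial shuffle
contributes to the wedge product. -/
theorem wedge_append (x : Fin n → A) (y : Fin m → A)
    (h : ∀ (w : Fin m → A) i j, w j = x i → β w = 0) :
    wedge α β τ (Fin.append x y) = τ (α x) (β y) := by
  rw [wedge_apply]
  refine (Finset.sum_eq_single (Quotient.mk'' 1 : Equiv.Perm.ModSumCongr (Fin n) (Fin m))
    ?_ (by simp)).trans ?_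
  · intro σ _ hσ
    induction σ using Quotient.inductionOn' with | _ σ
    rw [lift_summand_mk]
    -- A permutation preserving the right block represents the trivial coset. Any other sends a
    -- right index to the left block, so that β receives some x i and vanishes.
    by_cases hm : Set.MapsTo σ (Set.range Sum.inr) (Set.range Sum.inr)
    · refine absurd ?_ hσ
      have hr := Equiv.Perm.mem_sumCongrHom_range_of_perm_mapsTo_inl
        ((Equiv.Perm.perm_mapsTo_inl_iff_mapsTo_inr σ).2 hm)
      refine Quotient.sound' (QuotientGroup.leftRel_apply.2 ?_)
      rw [mul_one]
      exact inv_mem hr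
    · simp only [Set.MapsTo, Set.mem_range, forall_exists_index, forall_apply_eq_imp_iff,
        not_forall, not_exists] at hm
      obtain ⟨j, hj⟩ := hm
      obtain ⟨i, hi⟩ : ∃ i, σ (Sum.inr j) = Sum.inl i := by
        rcases hc : σ (Sum.inr j) with i | k
        · exact ⟨i, rfl⟩
        · exact absurd hc.symm (hj k)
      rw [h (fun j => Fin.append x y (finSumFinEquiv (σ (Sum.inr j)))) i j (by simp [hi]), map_zero,
        smul_zero]
  · rw [lift_summand_mk]
    simp

end

end Wedge

/-! ### The split case -/

section Splitting

variable {R : Type v} [CommRing R] {S : Scheme.{u}} {M₁ M₂ M₃ : ModuleScheme.{u} R S}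

theorem IsShortExact.exists_retraction {ι : M₁ ⟶ M₂} {π : M₂ ⟶ M₃} (hex : IsShortExact ι π)
    (s : M₃ ⟶ M₂) (hs : s ≫ π = 𝟙 M₃) :
    ∃ p : M₂ ⟶ M₁, ∀ X x, p.hom.app X (ι.hom.app X x) = x := by
  have hs' : ∀ X z, π.hom.app X (s.hom.app X z) = z := fun X z =>
    ConcreteCategory.congr_hom (NatTrans.congr_app (congrArg (fun k => k.hom) hs) X) z
  have key : ∀ X y, ∃ x, ι.hom.app X x = y - s.hom.app X (π.hom.app X y) := fun X y =>
    (hex.exact X _).1 (by rw [map_sub, hs', sub_self])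
  choose p hp using key
  refine ⟨ObjectProperty.homMk
    { app := fun X => ModuleCat.ofHom
        { toFun := p X
          map_add' := fun a b => hex.injective X (by rw [map_add, hp, hp, hp]; simp; abel)
          map_smul' := fun c a => hex.injective X (by
            rw [RingHom.id_apply, map_smul, hp, hp, map_smul, map_smul, smul_sub]) }
      naturality := fun X Y f => ?_ }, fun X x => ?_⟩
  · ext y
    refine hex.injective Y ?_
    change ι.hom.app Y (p Y (M₂.obj.map f y)) = ι.hom.app Y (M₁.obj.map f (p X y))
    rw [hp, NatTrans.naturality_apply ι.hom, hp, map_sub, NatTrans.naturality_apply π.hom,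
      NatTrans.naturality_apply s.hom]
  · refine hex.injective X ?_
    change ι.hom.app X (p X _) = _
    rw [hp, (hex.exact X).apply_apply_eq_zero, map_zero, sub_zero]

/-- If the sequence splits, the canonical morphism `E₁ ⊗ E₃ → E₂` has a retraction. -/
theorem exists_comp_eq_id {ι : M₁ ⟶ M₂} {π : M₂ ⟶ M₃} (hex : IsShortExact ι π)
    (s : M₃ ⟶ M₂) (hs : s ≫ π = 𝟙 M₃) {n₁ n₃ : ℕ} {E₁ E₂ E₃ T : ModuleScheme.{u} R S}
    {lam₁ : Alt M₁.obj E₁.obj n₁} {lam₂ : Alt M₂.obj E₂.obj (n₁ + n₃)}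
    {lam₃ : Alt M₃.obj E₃.obj n₃} {τ : Bilin E₁.obj E₃.obj T.obj}
    (h₁ : IsExteriorPower M₁ E₁ n₁ lam₁) (h₂ : IsExteriorPower M₂ E₂ (n₁ + n₃) lam₂)
    (h₃ : IsExteriorPower M₃ E₃ n₃ lam₃) (hT : IsTensorProduct E₁ E₃ T τ)
    (hA : InnerAltExists M₃ n₃ T) (hH : InnerHomExists E₁ T) (ζ : T ⟶ E₂)
    (hζ : ∀ X (x : Fin n₁ → M₁.obj.obj X) (y : Fin n₃ → M₂.obj.obj X),
      (ζ.hom.app X) (τ.1 X (lam₁.1 X x) (lam₃.1 X fun j => (π.hom.app X) (y j)))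
        = lam₂.1 X (Fin.append (fun i => (ι.hom.app X) (x i)) y)) :
    ∃ f : E₂ ⟶ T, ζ ≫ f = 𝟙 T := by
  obtain ⟨p, hp⟩ := hex.exists_retraction s hs
  -- Ψ is the wedge product of λ₁ ∘ p and λ₃ ∘ π; it induces the retraction of ζ.
  let Ψ : Alt M₂.obj T.obj (n₁ + n₃) := ⟨fun X =>
    wedge ((lam₁.1 X).compLinearMap (p.hom.app X).hom) ((lam₃.1 X).compLinearMap (π.hom.app X).hom)
      (τ.1 X), fun X Y f v => by
        refine map_wedge _ _ _ _ _ _ (fun a => M₂.obj.map f a) (T.obj.map f).hom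
          (fun x y => ?_) v
        change T.obj.map f (τ.1 X (lam₁.1 X fun i => p.hom.app X (x i))
            (lam₃.1 X fun i => π.hom.app X (y i)))
          = τ.1 Y (lam₁.1 Y fun i => p.hom.app Y (M₂.obj.map f (x i)))
            (lam₃.1 Y fun i => π.hom.app Y (M₂.obj.map f (y i)))
        rw [τ.2, lam₁.2, lam₃.2]
        simp only [NatTrans.naturality_apply]⟩
  have hΨ : ∀ X x y, Ψ.1 X (Fin.append (fun i => ι.hom.app X (x i)) y)
      = τ.1 X (lam₁.1 X x) (lam₃.1 X fun j => π.hom.app X (y j)) := by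
    intro X x y
    refine (wedge_append _ _ _ _ _ fun w i j hw => ?_).trans ?_
    · refine (lam₃.1 X).map_coord_zero j ?_
      change π.hom.app X (w j) = 0
      rw [hw]
      exact (hex.exact X).apply_apply_eq_zero _
    · change τ.1 X (lam₁.1 X fun i => p.hom.app X (ι.hom.app X (x i))) _ = _
      simp only [hp]
      rfl
  obtain ⟨f, hf, -⟩ := h₂.existsUnique_hom T Ψ
  refine ⟨f, ?_⟩
  let β : BiAlt M₁.obj M₃.obj T.obj n₁ n₃ := ⟨fun X =>
    LinearMap.compAlternatingMap
      ({ toFun := fun l => l.compAlternatingMap (lam₃.1 X)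
         map_add' := fun _ _ => rfl
         map_smul' := fun _ _ => rfl } :
        (E₃.obj.obj X →ₗ[R] T.obj.obj X) →ₗ[R] (M₃.obj.obj X) [⋀^Fin n₃]→ₗ[R] (T.obj.obj X))
      ((τ.1 X).compAlternatingMap (lam₁.1 X)), fun X Y k x z => by
        change T.obj.map k (τ.1 X (lam₁.1 X x) (lam₃.1 X z)) = τ.1 Y (lam₁.1 Y _) (lam₃.1 Y _)
        rw [τ.2, lam₁.2, lam₃.2]⟩
  refine (hT.existsUnique_hom_of_biAlt h₁ h₃ hA hH β).unique (fun X x z => ?_) (fun X x z => rfl)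
  have hs' : ∀ z, π.hom.app X (s.hom.app X z) = z := fun z =>
    ConcreteCategory.congr_hom (NatTrans.congr_app (congrArg (fun k => k.hom) hs) X) z
  -- The formula for ζ involves only arguments of the form π y; the section s puts every z in this
  -- form.
  have e : z = fun j => π.hom.app X (s.hom.app X (z j)) := funext fun j => (hs' _).symm
  rw [e]
  change f.hom.app X (ζ.hom.app X (τ.1 X _ _)) = τ.1 X _ _
  rw [hζ, hf, hΨ]
  rfl

end Splitting

end RModuleSchemes

/-! ### The main theorem -/

open RModuleSchemes in
theorem theorem4 {R : Type v} [CommRing R] {S : Scheme.{u}}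
    {M₁ M₂ M₃ : ModuleScheme.{u} R S} (ι : M₁ ⟶ M₂) (π : M₂ ⟶ M₃) (hex : IsShortExact ι π)
    (n₁ n₃ : ℕ) :
    -- the map `π^*` of the diagram is a monomorphism
    (∀ N : ModuleScheme.{u} R S,
      Function.Injective (pullbackBiAlt M₁.obj π.hom N.obj n₁ n₃)) ∧
    -- (a)
    (ExteriorPowerIsZero M₃ (n₃ + 1) →
      ∀ N : ModuleScheme.{u} R S, InnerMultsExist M₁ M₂ M₃ (n₁ + n₃) N →
        Function.Injective (restrictAlt ι.hom N.obj n₁ n₃)) ∧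
    -- (b)
    (ExteriorPowerIsZero M₁ (n₁ + 1) →
      ∀ N : ModuleScheme.{u} R S, InnerMultsExist M₁ M₂ M₃ (n₁ + n₃) N →
        ∃ μ : Alt M₂.obj N.obj (n₁ + n₃) →ₗ[R] BiAlt M₁.obj M₃.obj N.obj n₁ n₃,
          restrictAlt ι.hom N.obj n₁ n₃ = pullbackBiAlt M₁.obj π.hom N.obj n₁ n₃ ∘ₗ μ) ∧
    -- (c) and (d)
    (ExteriorPowerIsZero M₃ (n₃ + 1) → ExteriorPowerIsZero M₁ (n₁ + 1) →
      ∀ (E₁ E₂ E₃ T : ModuleScheme.{u} R S)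
        (lam₁ : Alt M₁.obj E₁.obj n₁) (lam₂ : Alt M₂.obj E₂.obj (n₁ + n₃))
        (lam₃ : Alt M₃.obj E₃.obj n₃) (τ : Bilin E₁.obj E₃.obj T.obj),
        IsExteriorPower M₁ E₁ n₁ lam₁ → IsExteriorPower M₂ E₂ (n₁ + n₃) lam₂ →
        IsExteriorPower M₃ E₃ n₃ lam₃ → IsTensorProduct E₁ E₃ T τ →
        InnerMultsExist M₁ M₂ M₃ (n₁ + n₃) E₂ →
        InnerAltExists M₃ n₃ E₂ → InnerHomExists E₁ E₂ →
        ∃ ζ : T ⟶ E₂,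
          -- `ζ` is the canonical morphism, and is determined by this property
          (∀ X (x : Fin n₁ → M₁.obj.obj X) (y : Fin n₃ → M₂.obj.obj X),
            (ζ.hom.app X) (τ.1 X (lam₁.1 X x) (lam₃.1 X fun j => (π.hom.app X) (y j)))
              = lam₂.1 X (Fin.append (fun i => (ι.hom.app X) (x i)) y)) ∧
          (∀ ζ' : T ⟶ E₂,
            (∀ X (x : Fin n₁ → M₁.obj.obj X) (y : Fin n₃ → M₂.obj.obj X),
              (ζ'.hom.app X) (τ.1 X (lam₁.1 X x) (lam₃.1 X fun j => (π.hom.app X) (y j)))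
                = lam₂.1 X (Fin.append (fun i => (ι.hom.app X) (x i)) y)) → ζ' = ζ) ∧
          -- `ζ` is an epimorphism
          (∀ N : ModuleScheme.{u} R S, InnerMultsExist M₁ M₂ M₃ (n₁ + n₃) N →
            Function.Injective (fun f : E₂ ⟶ N => ζ ≫ f)) ∧
          ((∀ N : ModuleScheme.{u} R S, InnerMultsExist M₁ M₂ M₃ (n₁ + n₃) N) → Epi ζ) ∧
          -- (d)
          ((∃ s : M₃ ⟶ M₂, s ≫ π = 𝟙 M₃) →
            InnerAltExists M₃ n₃ T → InnerHomExists E₁ T → IsIso ζ)) := by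
  have hπ := hex.locally_surjective
  refine ⟨fun N => pullbackBiAlt_injective N.isSheaf hπ n₁ n₃,
    fun h N hN => restrictAlt_injective hex h hN,
    fun h N hN => exists_restrictAlt_eq_pullbackBiAlt_comp hex h hN, ?_⟩
  intro hz₃ hz₁ E₁ E₂ E₃ T lam₁ lam₂ lam₃ τ h₁ h₂ h₃ hT hN hA hH
  obtain ⟨β, hβ⟩ := exists_pullbackBiAlt_eq_restrictAlt hex hz₁ hN lam₂
  have hβ' : ∀ X (x : Fin n₁ → M₁.obj.obj X) (y : Fin n₃ → M₂.obj.obj X),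
      β.1 X x (fun j => π.hom.app X (y j))
        = lam₂.1 X (Fin.append (fun i => ι.hom.app X (x i)) y) := fun X x y =>
    congrArg (fun b => b.1 X x y) hβ
  obtain ⟨ζ, hζβ, hu⟩ := hT.existsUnique_hom_of_biAlt h₁ h₃ hA hH β
  have hζ : ∀ X (x : Fin n₁ → M₁.obj.obj X) (y : Fin n₃ → M₂.obj.obj X),
      (ζ.hom.app X) (τ.1 X (lam₁.1 X x) (lam₃.1 X fun j => (π.hom.app X) (y j)))
        = lam₂.1 X (Fin.append (fun i => (ι.hom.app X) (x i)) y) := fun X x y =>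
    (hζβ X x _).trans (hβ' X x y)
  have hinj : ∀ N : ModuleScheme.{u} R S, InnerMultsExist M₁ M₂ M₃ (n₁ + n₃) N →
      Function.Injective (fun f : E₂ ⟶ N => ζ ≫ f) := by
    intro N hN f f' hff
    let φ : (E₂ ⟶ N) → Alt M₂.obj N.obj (n₁ + n₃) := fun f =>
      ⟨fun X => (f.hom.app X).hom.compAlternatingMap (lam₂.1 X), fun X Y k v => by
        change N.obj.map k (f.hom.app X (lam₂.1 X v)) = f.hom.app Y (lam₂.1 Y _)
        rw [← lam₂.2, NatTrans.naturality_apply]⟩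
    -- On arguments (ιx, y) the morphism λ₂ takes values in the image of ζ, so f and f' agree there;
    -- part (a) extends the equality to all of M₂^{n₂}.
    have hφ : φ f = φ f' := by
      refine restrictAlt_injective hex hz₃ hN (Subtype.ext (funext fun X => ?_))
      ext x y
      change f.hom.app X (lam₂.1 X (Fin.append (fun i => ι.hom.app X (x i)) y))
        = f'.hom.app X (lam₂.1 X (Fin.append (fun i => ι.hom.app X (x i)) y))
      rw [← hζ]
      exact ConcreteCategory.congr_hom
        (NatTrans.congr_app (congrArg (fun k => k.hom) hff) X) _
    exact (h₂.existsUnique_hom N (φ f)).unique (fun X x => rfl)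
      (fun X x => by rw [hφ]; rfl)
  refine ⟨ζ, hζ, fun ζ' hζ' => ?_, hinj, fun hall => ⟨fun f f' h => hinj _ (hall _) h⟩, ?_⟩
  · let γ : BiAlt M₁.obj M₃.obj E₂.obj n₁ n₃ := ⟨fun X =>
      LinearMap.compAlternatingMap
        ({ toFun := fun l => ((ζ'.hom.app X).hom ∘ₗ l).compAlternatingMap (lam₃.1 X)
           map_add' := fun a b => by ext; simp
           map_smul' := fun c a => by ext; simp } :
          (E₃.obj.obj X →ₗ[R] T.obj.obj X) →ₗ[R] (M₃.obj.obj X) [⋀^Fin n₃]→ₗ[R] (E₂.obj.obj X))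
        ((τ.1 X).compAlternatingMap (lam₁.1 X)), fun X Y k x z => by
          change E₂.obj.map k (ζ'.hom.app X (τ.1 X (lam₁.1 X x) (lam₃.1 X z)))
            = ζ'.hom.app Y (τ.1 Y (lam₁.1 Y _) (lam₃.1 Y _))
          rw [← lam₁.2, ← lam₃.2, ← τ.2, NatTrans.naturality_apply]⟩
    have hγ : γ = β := by
      refine pullbackBiAlt_injective E₂.isSheaf hπ n₁ n₃ (Subtype.ext (funext fun X => ?_))
      ext x y
      exact (hζ' X x y).trans (hβ' X x y).symm
    exact hu ζ' fun X x z => congrArg (fun b => b.1 X x z) hγ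
  · rintro ⟨s, hs⟩ hA' hH'
    obtain ⟨f, hf⟩ := exists_comp_eq_id hex s hs h₁ h₂ h₃ hT hA' hH' ζ hζ
    -- The second inverse identity follows by cancelling ζ on the left, which is allowed because E₂
    -- itself is admissible.
    refine ⟨f, hf, hinj E₂ hN ?_⟩
    change ζ ≫ f ≫ ζ = ζ ≫ 𝟙 E₂
    rw [← Category.assoc, hf, Category.id_comp, Category.comp_id]
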